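/- **Model.** Let $n\ge 1$ and $L\ge 1$, $N=L^2$. The lattice is the $L\times L$ piece of the triangular lattice with periodic boundary conditions (sites $(\mathbb Z/L)^2$, the six directions being $\pm(1,0),\pm(0,1),\pm(1,-1)$). A configuration consists of $n$ agents on distinct sites, each in one of the states $\mathcal U$ (Unaware), $\mathcal A_\emptyset,\mathcal A_{\{A\}},\mathcal A_{\{W\}},\mathcal A_{\{A,W\}},\mathcal A_{\{C\}}$ (Aware; $A$ = alert token, $W$ = witness flag, $C$ = all-clear token). Two agents are neighbors if they occupy adjacent sites; $d(u)$ is the number of neighbors of $u$. An agent is a witness at iteration $t$ if its site belongs to the set of food sites at iteration $t$. Fix an integer $w\ge 1$, an upper bound on the number of witnesses at any time, and parameters $0<p<1/w$, $\lambda>0$, and an integer $\Delta\ge 6$. In each iteration of Adaptive $\alpha$-Compression an agent $u$ is chosen uniformly at random, and with probability $\tfrac12$ each it performs a state update or a movement. *State update.* (1) If $u$ is a witness without the $W$ flag, then with probability $p$ its state becomes $\mathcal A_{\{W\}}$. (2) If $u$ is not a witness but has the $W$ flag, all its Aware neighbors get state $\mathcal A_{\{C\}}$ and $u$ becomes $\mathcal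 U$. (3) Otherwise: if $u$ is in state $\mathcal U$ and some neighbor has an alert token, one such neighbor (chosen by any fixed, possibly randomized, rule) loses it and $u$ becomes $\mathcal A_\emptyset$; if $u$ holds an alert token then, with probability $d(u)/\Delta$, a uniformly random neighbor $v$ is picked, and if $v$ is in state $\mathcal A_\emptyset$ or $\mathcal A_{\{W\}}$ the token moves from $u$ to $v$; if $u$ is in state $\mathcal A_{\{W\}}$, it gets an alert token with probability $p$; if $u$ is in state $\mathcal A_{\{C\}}$, all its Aware neighbors get state $\mathcal A_{\{C\}}$ and $u$ becomes $\mathcal U$. *Movement.* Witnesses and agents in states $\mathcal A_{\{W\}},\mathcal A_{\{A,W\}},\mathcal A_{\{C\}}$ do not move. An agent in state $\mathcal U$ picks a uniformly random direction and moves to the adjacent site in that direction if it is unoccupied. An agent $u$ in state $\mathcal A_\emptyset$ or $\mathcal A_{\{A\}}$ at site $\ell$ picks a uniformly random direction, leading to site $\ell'$, and if the move is a valid compression move it moves to $\ell'$ with probability $\min\{1,\lambda^{d'-d}\}$, where $d,d'$ are the numbers of Aware neighbors $u$ has at $\ell$ and would have at $\ell'$. With $N(\cdot)$ denoting sets of Aware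 agents on adjacent sites and $S=N(\ell)\cap N(\ell')$, the move is valid if $\ell'$ is unoccupied, $|N(\ell)|<5$, and either (i) $S\neq\emptyset$ and every agent of $(N(\ell)\cup N(\ell'))\setminus\{u\}$ is joined to an agent of $S$ by a path inside that set, or (ii) $S=\emptyset$, the sets $N(\ell)$ and $N(\ell')\setminus\{u\}$ are nonempty, and each of these two sets is connected. The set of food sites at each iteration is chosen by an arbitrary, possibly randomized, adversary that may depend on the past and present. The initial configuration satisfies the state invariant: every connected component of the set of Aware agents contains an agent in state $\mathcal A_{\{W\}},\mathcal A_{\{A,W\}}$ or $\mathcal A_{\{C\}}$ (for example, all agents are Unaware). **Theorem.** There is a constant $C$, independent of all the data above, such that the following holds. Let $T\in\mathbb N$ and suppose that almost surely there is no witness at any iteration $t\ge T$. Then: 1. the expected number of iterations after time $T$ until all agents are, and from then on remain, Unaware is at most $C n^2$; 2. as $t\to\infty$, the agents' positions converge in distribution to the uniform distribution over non-overlapping lattice placements: the set of occupied sites converges to the uniform distribution on the $n$-element sets of sites, and, if $n<N$, the joint placement of the individual (labelled) agents converges to the uniform distribution on the injective maps from the agents to the sites. -/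

import Mathlib

open scoped ENNReal NNReal Topology
open Filter MeasureTheory

noncomputable section

/-! ### Agent states -/

/-- The six states of an agent: `unaware` is `𝓤`; the other five are the Aware states
`𝓐_∅`, `𝓐_{A}`, `𝓐_{W}`, `𝓐_{A,W}`, `𝓐_{C}` (alert, witness and all-clear flags). -/
inductive AgentState where
  | unaware
  | aware
  | awareA
  | awareW
  | awareAW
  | awareC
  deriving DecidableEq

namespace AgentState

def IsAware (s : AgentState) : Prop := s ≠ unaware

/-- The agent holds an alert token. -/
def HasAlert (s : AgentState) : Prop := s = awareA ∨ s = awareAW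

/-- The witness flag is set. -/
def HasWitnessFlag (s : AgentState) : Prop := s = awareW ∨ s = awareAW

/-- Witness flag or all-clear flag set: the Immobile behaviour group. -/
def IsImmobile (s : AgentState) : Prop := s = awareW ∨ s = awareAW ∨ s = awareC

/-- Remove the alert token, if there is one. -/
def dropAlert : AgentState → AgentState
  | awareA => aware
  | awareAW => awareW
  | s => s

/-- Add an alert token to an Aware state without alert or all-clear token. -/
def addAlert : AgentState → AgentState
  | aware => awareA
  | awareW => awareAW
  | s => s

end AgentState

/-! ### The triangular lattice with periodic boundary conditions -/

/-- The `L × L` piece of the triangular lattice with periodic boundary, in the coordinates of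
a lattice basis at angle `π / 3`. -/
abbrev Site (L : ℕ) : Type := ZMod L × ZMod L

/-- The six lattice directions, in cyclic order. -/
def latticeDir (L : ℕ) : Fin 6 → Site L :=
  ![(1, 0), (0, 1), (-1, 1), (-1, 0), (0, -1), (1, -1)]

theorem exists_neg_latticeDir (L : ℕ) (d : Fin 6) :
    ∃ d' : Fin 6, latticeDir L d' = -latticeDir L d := by
  fin_cases d
  · exact ⟨3, by simp [latticeDir]⟩
  · exact ⟨4, by simp [latticeDir]⟩
  · exact ⟨5, by simp [latticeDir]⟩
  · exact ⟨0, by simp [latticeDir]⟩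
  · exact ⟨1, by simp [latticeDir]⟩
  · exact ⟨2, by simp [latticeDir]⟩

/-- Adjacency of lattice sites. -/
def latticeGraph (L : ℕ) : SimpleGraph (Site L) where
  Adj x y := x ≠ y ∧ ∃ d, y = x + latticeDir L d
  symm := ⟨by
    rintro x y ⟨hne, d, rfl⟩
    obtain ⟨d', hd'⟩ := exists_neg_latticeDir L d
    exact ⟨hne.symm, d', by rw [hd']; simp⟩⟩
  loopless := ⟨fun _ h => h.1 rfl⟩

/-! ### Configurations -/

/-- A configuration: `n` agents on distinct sites, each with a state. -/
structure Config (n L : ℕ) where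
  pos : Fin n ↪ Site L
  state : Fin n → AgentState

namespace Config

variable {n L : ℕ}

/-- Two agents are adjacent when they occupy adjacent sites. -/
def agentGraph (c : Config n L) : SimpleGraph (Fin n) := (latticeGraph L).comap c.pos

/-- The subgraph spanned by the Aware agents (Unaware agents are isolated vertices here). -/
def awareGraph (c : Config n L) : SimpleGraph (Fin n) where
  Adj u v := (c.state u).IsAware ∧ (c.state v).IsAware ∧ c.agentGraph.Adj u v
  symm := ⟨fun _ _ h => ⟨h.2.1, h.1, h.2.2.symm⟩⟩
  loopless := ⟨fun _ h => c.agentGraph.irrefl h.2.2⟩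

/-- The state invariant: every connected component of Aware agents contains an agent whose
witness flag or all-clear flag is set. -/
def StateInvariant (c : Config n L) : Prop :=
  ∀ u, (c.state u).IsAware → ∃ v, c.awareGraph.Reachable u v ∧ (c.state v).IsImmobile

def AllUnaware (c : Config n L) : Prop := ∀ u, c.state u = AgentState.unaware

open Classical in
/-- The witnesses: agents located on a food source, `F` being the set of sites with food. -/
def witnesses (c : Config n L) (F : Finset (Site L)) : Finset (Fin n) :=
  Finset.univ.filter fun u => c.pos u ∈ F

/-- The set of occupied sites. -/
def occupied (c : Config n L) : Finset (Site L) := Finset.univ.map c.pos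

open Classical in
/-- All agents adjacent to `u`. -/
def nbrs (c : Config n L) (u : Fin n) : Finset (Fin n) :=
  Finset.univ.filter fun v => c.agentGraph.Adj u v

open Classical in
/-- The neighbours of `u` that hold an alert token. -/
def alertNbrs (c : Config n L) (u : Fin n) : Finset (Fin n) :=
  (c.nbrs u).filter fun v => (c.state v).HasAlert

def setState (c : Config n L) (u : Fin n) (s : AgentState) : Config n L where
  pos := c.pos
  state := Function.update c.state u s

open Classical in
/-- `u` sends an all-clear token to all its Aware neighbours and becomes Unaware. -/
def broadcastClear (c : Config n L) (u : Fin n) : Config n L where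
  pos := c.pos
  state := fun v =>
    if v = u then AgentState.unaware
    else if v ∈ c.nbrs u ∧ (c.state v).IsAware then AgentState.awareC
    else c.state v

/-- `u` becomes Aware by consuming the alert token of `v`. -/
def consumeAlert (c : Config n L) (u v : Fin n) : Config n L :=
  (c.setState v (c.state v).dropAlert).setState u AgentState.aware

open Classical in
/-- `u` hands its alert token to `v`, provided `v` is Aware without alert or all-clear token. -/
def passAlert (c : Config n L) (u v : Fin n) : Config n L :=
  if c.state v = AgentState.aware ∨ c.state v = AgentState.awareW then
    (c.setState u (c.state u).dropAlert).setState v (c.state v).addAlert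
  else c

open Classical in
/-- Agent `u` moves to the site `ℓ` if that site is unoccupied; otherwise nothing happens. -/
def moveTo (c : Config n L) (u : Fin n) (ℓ : Site L) : Config n L :=
  if h : ∀ v, c.pos v ≠ ℓ then
    { pos := ⟨Function.update c.pos u ℓ, by
        intro a b hab
        by_cases ha : a = u <;> by_cases hb : b = u
        · exact ha.trans hb.symm
        · subst ha
          rw [Function.update_self, Function.update_of_ne hb] at hab
          exact absurd hab.symm (h b)
        · subst hb
          rw [Function.update_self, Function.update_of_ne ha] at hab
          exact absurd hab (h a)
        · rw [Function.update_of_ne ha, Function.update_of_ne hb] at hab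
          exact c.pos.injective hab⟩
      state := c.state }
  else c

/-! ### Compression moves -/

open Classical in
/-- The Aware agents on sites adjacent to the site `ℓ`. -/
def awareAround (c : Config n L) (ℓ : Site L) : Finset (Fin n) :=
  Finset.univ.filter fun v => (c.state v).IsAware ∧ (latticeGraph L).Adj ℓ (c.pos v)

/-- `v` and `w` belong to `S` and are joined by a path of adjacent agents inside `S`. -/
def JoinedIn (c : Config n L) (S : Finset (Fin n)) (v w : Fin n) : Prop :=
  ∃ (hv : v ∈ (S : Set (Fin n))) (hw : w ∈ (S : Set (Fin n))),
    (c.agentGraph.induce (S : Set (Fin n))).Reachable ⟨v, hv⟩ ⟨w, hw⟩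

open Classical in
/-- First local connectivity property for moving `u` (at site `ℓ = c.pos u`) to `ℓ'`. -/
def MoveProperty1 (c : Config n L) (u : Fin n) (ℓ' : Site L) : Prop :=
  (c.awareAround (c.pos u) ∩ c.awareAround ℓ').Nonempty ∧
  ∀ v ∈ (c.awareAround (c.pos u) ∪ c.awareAround ℓ').erase u,
    ∃ w ∈ c.awareAround (c.pos u) ∩ c.awareAround ℓ',
      c.JoinedIn ((c.awareAround (c.pos u) ∪ c.awareAround ℓ').erase u) v w

open Classical in
/-- Second local connectivity property for moving `u` (at site `ℓ = c.pos u`) to `ℓ'`. -/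
def MoveProperty2 (c : Config n L) (u : Fin n) (ℓ' : Site L) : Prop :=
  c.awareAround (c.pos u) ∩ c.awareAround ℓ' = ∅ ∧
  (c.awareAround (c.pos u)).Nonempty ∧
  ((c.awareAround ℓ').erase u).Nonempty ∧
  (∀ v ∈ c.awareAround (c.pos u), ∀ w ∈ c.awareAround (c.pos u),
    c.JoinedIn (c.awareAround (c.pos u)) v w) ∧
  (∀ v ∈ (c.awareAround ℓ').erase u, ∀ w ∈ (c.awareAround ℓ').erase u,
    c.JoinedIn ((c.awareAround ℓ').erase u) v w)

/-- Moving `u` to `ℓ'` is a valid compression move. -/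
def ValidCompressionMove (c : Config n L) (u : Fin n) (ℓ' : Site L) : Prop :=
  (∀ v, c.pos v ≠ ℓ') ∧
  (c.awareAround (c.pos u)).card < 5 ∧
  (c.MoveProperty1 u ℓ' ∨ c.MoveProperty2 u ℓ')

end Config

/-! ### The algorithm, as a random map on configurations -/

/-- A coin showing `true` with probability `r`, clipped to `[0, 1]`. -/
def coin (r : ℝ) : PMF Bool :=
  PMF.ofFintype (fun b => if b then min 1 (ENNReal.ofReal r) else 1 - min 1 (ENNReal.ofReal r))
    (by simp)

/-- Continue with `a` with probability `r` (clipped to `[0, 1]`) and with `b` otherwise; that is,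
continue with `a` exactly when a uniform random number in `[0, 1]` is at most `r`. -/
def chance {α : Type*} (r : ℝ) (a b : PMF α) : PMF α :=
  (coin r).bind fun x => if x then a else b

/-- A rule, possibly randomized, by which an Unaware agent selects one of several neighbours that
hold an alert token. -/
structure AlertChoice (n L : ℕ) where
  pick : Config n L → Fin n → PMF (Fin n)
  mem_alertNbrs : ∀ c u, (c.alertNbrs u).Nonempty → ∀ v ∈ (pick c u).support, v ∈ c.alertNbrs u

section Algorithm

variable {n L : ℕ}

open Classical in
/-- The Adaptive Stimuli Algorithm executed by `u`. -/
def adaptiveStimuli (p : ℝ) (Δ : ℕ) (χ : AlertChoice n L) (F : Finset (Site L))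
    (c : Config n L) (u : Fin n) : PMF (Config n L) :=
  if c.pos u ∈ F ∧ ¬ (c.state u).HasWitnessFlag then
    chance p (PMF.pure (c.setState u AgentState.awareW)) (PMF.pure c)
  else if c.pos u ∉ F ∧ (c.state u).HasWitnessFlag then
    PMF.pure (c.broadcastClear u)
  else match c.state u with
    | AgentState.unaware =>
        if (c.alertNbrs u).Nonempty then (χ.pick c u).map (c.consumeAlert u) else PMF.pure c
    | AgentState.aware => PMF.pure c
    | AgentState.awareA | AgentState.awareAW =>
        if h : (c.nbrs u).Nonempty then
          chance (((c.nbrs u).card : ℝ) / Δ)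
            ((PMF.uniformOfFinset (c.nbrs u) h).map (c.passAlert u)) (PMF.pure c)
        else PMF.pure c
    | AgentState.awareW =>
        chance p (PMF.pure (c.setState u AgentState.awareAW)) (PMF.pure c)
    | AgentState.awareC => PMF.pure (c.broadcastClear u)

open Classical in
/-- Gather move of `u`: a Metropolis step of the compression algorithm with bias `lam`. -/
def executeGather (lam : ℝ) (c : Config n L) (u : Fin n) : PMF (Config n L) :=
  (PMF.uniformOfFintype (Fin 6)).bind fun d =>
    let ℓ' := c.pos u + latticeDir L d
    if c.ValidCompressionMove u ℓ' then
      chance (lam ^ ((((c.awareAround ℓ').erase u).card : ℤ) - ((c.awareAround (c.pos u)).card : ℤ)))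
        (PMF.pure (c.moveTo u ℓ')) (PMF.pure c)
    else PMF.pure c

/-- Search move of `u`: simple exclusion. -/
def executeSearch (c : Config n L) (u : Fin n) : PMF (Config n L) :=
  (PMF.uniformOfFintype (Fin 6)).map fun d => c.moveTo u (c.pos u + latticeDir L d)

open Classical in
/-- The movement part of Adaptive `α`-Compression for agent `u`. -/
def executeMove (lam : ℝ) (F : Finset (Site L)) (c : Config n L) (u : Fin n) :
    PMF (Config n L) :=
  if c.pos u ∈ F ∨ (c.state u).IsImmobile then PMF.pure c
  else if (c.state u).IsAware then executeGather lam c u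
  else executeSearch c u

/-- One iteration of Adaptive `α`-Compression when `F` is the current set of food sites: a uniformly
random agent is activated and makes, with probability `1 / 2` each, a state update or a move. -/
def compressionStep [NeZero n] (p lam : ℝ) (Δ : ℕ) (χ : AlertChoice n L) (F : Finset (Site L))
    (c : Config n L) : PMF (Config n L) :=
  (PMF.uniformOfFintype (Fin n)).bind fun u =>
    chance (1 / 2) (adaptiveStimuli p Δ χ F c u) (executeMove lam F c u)

end Algorithm

/-! ### Runs -/

/-- `X t`, `F t` (the configuration and the set of food sites at the beginning of iteration `t`) form
a run with one-step law `K`: given the whole history `(X 0, F 0), …, (X t, F t)`, the next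
configuration has law `K (F t) (X t)`. The food process `F` is otherwise arbitrary, so the food may
be placed by a randomized adversary that sees the entire past and present. -/
structure IsRun {n L : ℕ} {Ω : Type*} [MeasurableSpace Ω] (μ : Measure Ω)
    (K : Finset (Site L) → Config n L → PMF (Config n L))
    (X : ℕ → Ω → Config n L) (F : ℕ → Ω → Finset (Site L)) : Prop where
  measurableSet_config : ∀ t x, MeasurableSet {ω | X t ω = x}
  measurableSet_food : ∀ t f, MeasurableSet {ω | F t ω = f}
  step : ∀ (t : ℕ) (x : ℕ → Config n L) (f : ℕ → Finset (Site L)) (y : Config n L),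
    μ {ω | (∀ s ≤ t, X s ω = x s ∧ F s ω = f s) ∧ X (t + 1) ω = y} =
      μ {ω | ∀ s ≤ t, X s ω = x s ∧ F s ω = f s} * K (f t) (x t) y

/-- The number of iterations after time `T` until all agents are, and from then on remain, Unaware
(`∞` if this never happens). -/
def unawareTime {n L : ℕ} {Ω : Type*} (X : ℕ → Ω → Config n L) (T : ℕ) (ω : Ω) : ℝ≥0∞ :=
  ⨅ (k : ℕ) (_ : ∀ s ≥ T + k, (X s ω).AllUnaware), (k : ℝ≥0∞)

end

/-! The process splits into a clearing phase and an exclusion phase.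

Clearing. Each iteration preserves the state invariant, whatever the food. The delicate cases are a
broadcast, which deletes a vertex of the Aware graph but turns all its Aware neighbours into
all-clear agents, and a compression move, whose local connectivity conditions allow any path through
the mover to be rerouted. Once there are no witnesses, consider the potential "Aware agents plus
alert tokens", which lies between 0 and `2 * n`. It never increases: consuming a token trades it for
an Aware agent. As long as some agent is Aware, the invariant supplies an immobile agent, and with
probability at least `1 / (2 * n)` such an agent is activated for a state update and broadcasts,
lowering the potential by at least one. Summing this drift over time, the probabilities of not being
all Unaware add up to at most `2 * n * (2 * n)`. Since the all-Unaware set is absorbing, this sum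
bounds the expected clearing time, with constant 4.

Exclusion. From an all-Unaware configuration the placements perform lazy simple exclusion, with a
symmetric, hence doubly stochastic, kernel and positive diagonal. If a site is free the chain is
irreducible even for labelled agents: a hole next to two adjacent agents lets them be exchanged
around a triangle, the hole can be walked there and back, and adjacent transpositions generate all
permutations of the sites. A Doeblin contraction then gives convergence to the uniform law. Finally,
nearly all mass is all-Unaware at some late time, so every placement has asymptotically at least the
uniform probability; as the total is one, equality holds in the limit. -/

noncomputable section

/-! ### Agent states and their weights -/

namespace AgentState

theorem IsImmobile.isAware {s : AgentState} (h : s.IsImmobile) : s.IsAware := by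
  rcases h with rfl | rfl | rfl <;> simp [IsAware]

theorem HasAlert.isAware {s : AgentState} (h : s.HasAlert) : s.IsAware := by
  rcases h with rfl | rfl <;> simp [IsAware]

theorem IsAware.dropAlert {s : AgentState} (hs : s.IsAware) : s.dropAlert.IsAware := by
  cases s <;> simp_all [IsAware, AgentState.dropAlert]

theorem IsImmobile.dropAlert {s : AgentState} (hs : s.IsImmobile) : s.dropAlert.IsImmobile := by
  rcases hs with rfl | rfl | rfl <;> simp [IsImmobile, AgentState.dropAlert]

theorem IsAware.addAlert {s : AgentState} (hs : s.IsAware) : s.addAlert.IsAware := by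
  cases s <;> simp_all [IsAware, AgentState.addAlert]

theorem IsImmobile.addAlert {s : AgentState} (hs : s.IsImmobile) : s.addAlert.IsImmobile := by
  rcases hs with rfl | rfl | rfl <;> simp [IsImmobile, AgentState.addAlert]

/-- The number of alert tokens of an agent, plus one if the agent is Aware. -/
def weight : AgentState → ℕ
  | unaware => 0
  | awareA | awareAW => 2
  | _ => 1

theorem weight_le_two (s : AgentState) : s.weight ≤ 2 := by cases s <;> simp [weight]

theorem weight_dropAlert {s : AgentState} (hs : s.HasAlert) : s.dropAlert.weight + 1 = s.weight := by
  rcases hs with rfl | rfl <;> simp [weight, dropAlert]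

instance : Finite AgentState := by
  let f : AgentState → Fin 6 := fun s => match s with
    | unaware => 0 | aware => 1 | awareA => 2 | awareW => 3 | awareAW => 4 | awareC => 5
  exact Finite.of_injective f (by intro a b; cases a <;> cases b <;> simp [f])

end AgentState

namespace Config

variable {n L : ℕ}

attribute [ext] Config

/-! ### The state invariant -/

/-- The component of `v` in the graph of Aware agents contains an immobile agent. -/
def Anchored (c : Config n L) (v : Fin n) : Prop :=
  ∃ w, c.awareGraph.Reachable v w ∧ (c.state w).IsImmobile

theorem Anchored.of_reachable {c : Config n L} {v w : Fin n} (hw : c.Anchored w)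
    (h : c.awareGraph.Reachable v w) : c.Anchored v :=
  let ⟨z, hz, hi⟩ := hw
  ⟨z, h.trans hz, hi⟩

theorem anchored_of_isImmobile {c : Config n L} {v : Fin n} (h : (c.state v).IsImmobile) :
    c.Anchored v := ⟨v, SimpleGraph.Reachable.refl v, h⟩

/-- A property of immobile agents that propagates along edges holds for all Aware agents. -/
theorem StateInvariant.induction {c : Config n L} (hc : c.StateInvariant) {G : Fin n → Prop}
    (immobile : ∀ v, (c.state v).IsImmobile → G v)
    (adj : ∀ a b, c.awareGraph.Adj a b → G b → G a) {v : Fin n} (hv : (c.state v).IsAware) :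
    G v := by
  obtain ⟨w, ⟨p⟩, hw⟩ := hc v hv
  induction p with
  | nil => exact immobile _ hw
  | cons h p ih => exact adj _ _ h (ih h.2.1 hw)

/-- Old paths to immobile agents survive when the Aware graph only grows and immobility persists; a
newly Aware agent must then be immobile itself or attached to an old Aware agent. -/
theorem StateInvariant.mono {c c' : Config n L} (hc : c.StateInvariant)
    (graph : c.awareGraph ≤ c'.awareGraph)
    (immobile : ∀ v, (c.state v).IsImmobile → (c'.state v).IsImmobile)
    (aware : ∀ v, (c'.state v).IsAware → (c.state v).IsAware ∨ (c'.state v).IsImmobile ∨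
      ∃ w, (c.state w).IsAware ∧ c'.awareGraph.Adj v w) : c'.StateInvariant := by
  have key : ∀ v, (c.state v).IsAware → c'.Anchored v := fun v hv => by
    obtain ⟨w, hw, hi⟩ := hc v hv
    exact ⟨w, hw.mono graph, immobile w hi⟩
  intro v hv
  rcases aware v hv with h | h | ⟨w, hw, h⟩
  · exact key v h
  · exact anchored_of_isImmobile h
  · exact (key w hw).of_reachable h.reachable

theorem StateInvariant.setState {c : Config n L} (hc : c.StateInvariant) {u : Fin n}
    {s : AgentState} (hs : s.IsAware) (hi : (c.state u).IsImmobile → s.IsImmobile)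
    (hu : (c.state u).IsAware ∨ s.IsImmobile ∨ ∃ w, (c.state w).IsAware ∧ c.agentGraph.Adj u w) :
    (c.setState u s).StateInvariant := by
  have key : ∀ v, (c.state v).IsAware → ((c.setState u s).state v).IsAware := by
    intro v hv
    by_cases h : v = u
    · subst h; simpa [Config.setState] using hs
    · simpa [Config.setState, h] using hv
  refine hc.mono (fun a b hab => ⟨key a hab.1, key b hab.2.1, hab.2.2⟩) ?_ ?_
  · intro v hv
    by_cases h : v = u
    · subst h; simpa [Config.setState] using hi hv
    · simpa [Config.setState, h] using hv
  · intro v hv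
    by_cases h : v = u
    · subst h
      rcases hu with h | h | ⟨w, hw, h⟩
      · exact Or.inl h
      · exact Or.inr (Or.inl (by simpa [Config.setState] using h))
      · exact Or.inr (Or.inr ⟨w, hw, hv, key w hw, h⟩)
    · exact Or.inl (by simpa [Config.setState, h] using hv)

theorem mem_nbrs {c : Config n L} {u v : Fin n} : v ∈ c.nbrs u ↔ c.agentGraph.Adj u v := by
  simp [nbrs]

theorem mem_alertNbrs {c : Config n L} {u v : Fin n} :
    v ∈ c.alertNbrs u ↔ c.agentGraph.Adj u v ∧ (c.state v).HasAlert := by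
  simp [alertNbrs, mem_nbrs]

theorem mem_awareAround {c : Config n L} {ℓ : Site L} {v : Fin n} :
    v ∈ c.awareAround ℓ ↔ (c.state v).IsAware ∧ (latticeGraph L).Adj ℓ (c.pos v) := by
  simp [awareAround]

theorem StateInvariant.consumeAlert {c : Config n L} (hc : c.StateInvariant) {u v : Fin n}
    (hu : c.state u = AgentState.unaware) (hv : v ∈ c.alertNbrs u) :
    (c.consumeAlert u v).StateInvariant := by
  rw [mem_alertNbrs] at hv
  have hvu : u ≠ v := hv.1.ne
  have hav := hv.2.isAware
  have h1 : (c.setState v (c.state v).dropAlert).StateInvariant :=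
    hc.setState hav.dropAlert AgentState.IsImmobile.dropAlert (Or.inl hav)
  refine h1.setState (by simp [AgentState.IsAware]) ?_ ?_
  · simp [Config.setState, hvu, hu, AgentState.IsImmobile]
  · exact Or.inr (Or.inr ⟨v, by simpa [Config.setState] using hav.dropAlert, hv.1⟩)

theorem StateInvariant.passAlert {c : Config n L} (hc : c.StateInvariant) {u v : Fin n}
    (hu : (c.state u).IsAware) : (c.passAlert u v).StateInvariant := by
  unfold Config.passAlert
  split_ifs with h
  · have hav : (c.state v).IsAware := by rcases h with h | h <;> simp [h, AgentState.IsAware]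
    have h1 : (c.setState u (c.state u).dropAlert).StateInvariant :=
      hc.setState hu.dropAlert AgentState.IsImmobile.dropAlert (Or.inl hu)
    refine h1.setState hav.addAlert ?_ ?_
    · intro hi
      by_cases hvu : v = u
      · subst hvu
        rcases h with h | h <;>
          simp_all [Config.setState, AgentState.IsImmobile, AgentState.dropAlert,
            AgentState.addAlert]
      · exact AgentState.IsImmobile.addAlert (by simpa [Config.setState, hvu] using hi)
    · left
      by_cases hvu : v = u
      · subst hvu; simpa [Config.setState] using hu.dropAlert
      · simpa [Config.setState, hvu] using hav
  · exact hc

/-- Losing `u` may disconnect its component, but a path that used to pass through `u` can be stopped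
just before it: the neighbour reached there now carries the all-clear token and is itself an anchor.
-/
theorem StateInvariant.broadcastClear {c : Config n L} (hc : c.StateInvariant) (u : Fin n) :
    (c.broadcastClear u).StateInvariant := by
  have aware : ∀ v, v ≠ u → (c.state v).IsAware → ((c.broadcastClear u).state v).IsAware := by
    intro v hvu hv
    simp only [Config.broadcastClear, if_neg hvu]
    split_ifs
    · simp [AgentState.IsAware]
    · exact hv
  have key : ∀ v, (c.state v).IsAware → v = u ∨ (c.broadcastClear u).Anchored v := by
    intro v hv
    refine hc.induction (G := fun v => v = u ∨ (c.broadcastClear u).Anchored v) ?_ ?_ hv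
    · intro v hv
      by_cases hvu : v = u
      · exact Or.inl hvu
      · refine Or.inr (anchored_of_isImmobile ?_)
        by_cases h : v ∈ c.nbrs u
        · simp [Config.broadcastClear, hvu, hv.isAware, h, AgentState.IsImmobile]
        · simpa [Config.broadcastClear, hvu, h] using hv
    · intro a b hab hb
      by_cases hau : a = u
      · exact Or.inl hau
      by_cases hbu : b = u
      · subst hbu
        refine Or.inr (anchored_of_isImmobile ?_)
        simp [Config.broadcastClear, hau, hab.1, mem_nbrs, hab.2.2.symm, AgentState.IsImmobile]
      · refine Or.inr ((hb.resolve_left hbu).of_reachable (SimpleGraph.Adj.reachable ?_))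
        exact ⟨aware a hau hab.1, aware b hbu hab.2.1, hab.2.2⟩
  intro v hv
  have hvu : v ≠ u := by
    rintro rfl
    simp [Config.broadcastClear, AgentState.IsAware] at hv
  refine (key v ?_).resolve_left hvu
  intro h
  simp [Config.broadcastClear, hvu, AgentState.IsAware, h] at hv

theorem moveTo_state (c : Config n L) (u : Fin n) (ℓ : Site L) :
    (c.moveTo u ℓ).state = c.state := by
  unfold moveTo; split_ifs <;> rfl

theorem moveTo_pos_self {c : Config n L} (u : Fin n) {ℓ : Site L} (h : ∀ v, c.pos v ≠ ℓ) :
    (c.moveTo u ℓ).pos u = ℓ := by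
  rw [moveTo, dif_pos h]
  exact Function.update_self ..

theorem moveTo_pos_of_ne (c : Config n L) {u v : Fin n} (hv : v ≠ u) (ℓ : Site L) :
    (c.moveTo u ℓ).pos v = c.pos v := by
  unfold moveTo
  split_ifs
  · exact Function.update_of_ne hv ..
  · rfl

theorem awareGraph_adj_moveTo {c : Config n L} {u a b : Fin n} (ℓ : Site L) (ha : a ≠ u)
    (hb : b ≠ u) (h : c.awareGraph.Adj a b) : (c.moveTo u ℓ).awareGraph.Adj a b := by
  refine ⟨by simpa [moveTo_state] using h.1, by simpa [moveTo_state] using h.2.1, ?_⟩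
  have := h.2.2
  simpa [agentGraph, moveTo_pos_of_ne, ha, hb] using this

theorem StateInvariant.moveTo_of_not_isAware {c : Config n L} (hc : c.StateInvariant) {u : Fin n}
    (hu : ¬ (c.state u).IsAware) (ℓ : Site L) : (c.moveTo u ℓ).StateInvariant := by
  refine hc.mono (fun a b hab => awareGraph_adj_moveTo ℓ ?_ ?_ hab) ?_ ?_
  · rintro rfl; exact hu hab.1
  · rintro rfl; exact hu hab.2.1
  · simp [moveTo_state]
  · intro v hv; exact Or.inl (by simpa [moveTo_state] using hv)

theorem JoinedIn.reachable_moveTo {c : Config n L} {S : Finset (Fin n)} {u v w : Fin n}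
    (h : c.JoinedIn S v w) (hS : ∀ x ∈ S, x ≠ u ∧ (c.state x).IsAware) (ℓ : Site L) :
    (c.moveTo u ℓ).awareGraph.Reachable v w := by
  obtain ⟨hv, hw, hr⟩ := h
  let f : c.agentGraph.induce (S : Set (Fin n)) →g (c.moveTo u ℓ).awareGraph :=
    { toFun := fun x => x.1
      map_rel' := fun {a b} hab =>
        awareGraph_adj_moveTo ℓ (hS a.1 a.2).1 (hS b.1 b.2).1
          ⟨(hS a.1 a.2).2, (hS b.1 b.2).2, hab⟩ }
  exact hr.map f

/-- The mover is not immobile, so no anchor is displaced. A path that visited `u` is repaired by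
joining the two old neighbours of `u` in the new configuration: under the first property through
common neighbours and `u` at its new site, under the second inside the old neighbourhood. Both
properties also give `u` an Aware neighbour at its new site. -/
theorem StateInvariant.moveTo_of_valid {c : Config n L} (hc : c.StateInvariant) {u : Fin n}
    (hu : (c.state u).IsAware) (hu' : ¬ (c.state u).IsImmobile) {ℓ : Site L}
    (h : c.ValidCompressionMove u ℓ) : (c.moveTo u ℓ).StateInvariant := by
  obtain ⟨hfree, -, hprop⟩ := h
  set c' := c.moveTo u ℓ with hc'
  have hadj : ∀ w, w ≠ u → w ∈ c.awareAround ℓ → c'.awareGraph.Adj u w := by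
    intro w hwu hw
    rw [mem_awareAround] at hw
    refine ⟨by simpa [hc', moveTo_state] using hu, by simpa [hc', moveTo_state] using hw.1, ?_⟩
    change (latticeGraph L).Adj (c'.pos u) (c'.pos w)
    rw [hc', moveTo_pos_self u hfree, moveTo_pos_of_ne _ hwu]
    exact hw.2
  have hne : ∀ w ∈ c.awareAround (c.pos u), w ≠ u := by
    rintro w hw rfl
    exact (mem_awareAround.1 hw).2.ne rfl
  have hold : ∀ a ∈ c.awareAround (c.pos u), ∀ b ∈ c.awareAround (c.pos u),
      c'.awareGraph.Reachable a b := by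
    rcases hprop with ⟨-, h1⟩ | ⟨-, -, -, h2, -⟩
    · have key : ∀ a ∈ c.awareAround (c.pos u), c'.awareGraph.Reachable u a := by
        intro a ha
        obtain ⟨w, hw, hj⟩ := h1 a
          (Finset.mem_erase.2 ⟨hne a ha, Finset.mem_union_left _ ha⟩)
        rw [Finset.mem_inter] at hw
        refine (hadj w (hne w hw.1) hw.2).reachable.trans (hj.reachable_moveTo ?_ ℓ).symm
        intro x hx
        rw [Finset.mem_erase, Finset.mem_union, mem_awareAround, mem_awareAround] at hx
        exact ⟨hx.1, hx.2.elim And.left And.left⟩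
      exact fun a ha b hb => (key a ha).symm.trans (key b hb)
    · intro a ha b hb
      refine (h2 a ha b hb).reachable_moveTo ?_ ℓ
      exact fun x hx => ⟨hne x hx, (mem_awareAround.1 hx).1⟩
  have hnew : ∃ w, w ≠ u ∧ w ∈ c.awareAround ℓ := by
    rcases hprop with ⟨⟨w, hw⟩, -⟩ | ⟨-, -, ⟨w, hw⟩, -, -⟩
    · rw [Finset.mem_inter] at hw
      exact ⟨w, hne w hw.1, hw.2⟩
    · rw [Finset.mem_erase] at hw
      exact ⟨w, hw.1, hw.2⟩
  -- The property propagated along old paths is anchoring for agents other than `u`, and for `u` the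
  -- anchoring of all its old neighbours; this carries the induction across a visit to `u`.
  have key : ∀ v, (c.state v).IsAware → (v ≠ u → c'.Anchored v) ∧
      (v = u → ∀ b ∈ c.awareAround (c.pos u), c'.Anchored b) := by
    intro v hv
    refine hc.induction (G := fun v => (v ≠ u → c'.Anchored v) ∧
      (v = u → ∀ b ∈ c.awareAround (c.pos u), c'.Anchored b)) ?_ ?_ hv
    · intro v hv
      refine ⟨fun _ => anchored_of_isImmobile (by simpa [hc', moveTo_state] using hv), ?_⟩
      rintro rfl
      exact absurd hv hu'
    · intro a b hab hb
      constructor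
      · intro hau
        by_cases hbu : b = u
        · refine hb.2 hbu a (mem_awareAround.2 ⟨hab.1, ?_⟩)
          rw [← hbu]
          exact hab.2.2.symm
        · exact (hb.1 hbu).of_reachable (awareGraph_adj_moveTo ℓ hau hbu hab).reachable
      · rintro rfl x hx
        have hbm : b ∈ c.awareAround (c.pos a) := mem_awareAround.2 ⟨hab.2.1, hab.2.2⟩
        exact (hb.1 (hne b hbm)).of_reachable (hold x hx b hbm)
  intro v hv
  have hv' : (c.state v).IsAware := by simpa [hc', moveTo_state] using hv
  by_cases hvu : v = u
  · obtain ⟨w, hwu, hw⟩ := hnew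
    rw [hvu]
    exact ((key w (mem_awareAround.1 hw).1).1 hwu).of_reachable (hadj w hwu hw).reachable
  · exact (key v hv').1 hvu

/-! ### The potential -/

/-- The number of Aware agents plus the number of alert tokens. -/
def weight (c : Config n L) : ℕ := ∑ v, (c.state v).weight

theorem weight_le (c : Config n L) : c.weight ≤ 2 * n := by
  refine (Finset.sum_le_sum fun v _ => (c.state v).weight_le_two).trans ?_
  simp [mul_comm]

theorem weight_setState_add (c : Config n L) (u : Fin n) (s : AgentState) :
    (c.setState u s).weight + (c.state u).weight = c.weight + s.weight := by
  unfold weight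
  rw [← Finset.add_sum_erase _ _ (Finset.mem_univ u),
    ← Finset.add_sum_erase Finset.univ (fun v => (c.state v).weight) (Finset.mem_univ u)]
  have : ∑ x ∈ Finset.univ.erase u, ((c.setState u s).state x).weight =
      ∑ x ∈ Finset.univ.erase u, (c.state x).weight :=
    Finset.sum_congr rfl fun x hx => by simp [Config.setState, Finset.ne_of_mem_erase hx]
  rw [this]
  simp only [Config.setState, Function.update_self]
  ring

/-- The token lost by `v` pays for the awareness gained by `u`; this is why the potential counts
tokens as well as Aware agents. -/
theorem weight_consumeAlert {c : Config n L} {u v : Fin n} (hu : c.state u = AgentState.unaware)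
    (hv : v ∈ c.alertNbrs u) : (c.consumeAlert u v).weight = c.weight := by
  rw [mem_alertNbrs] at hv
  have h1 := c.weight_setState_add v (c.state v).dropAlert
  have h2 := (c.setState v (c.state v).dropAlert).weight_setState_add u AgentState.aware
  have h3 := AgentState.weight_dropAlert hv.2
  have h4 : (c.setState v (c.state v).dropAlert).state u = AgentState.unaware := by
    simp [Config.setState, hv.1.ne, hu]
  rw [h4] at h2
  simp only [AgentState.weight] at h2
  unfold Config.consumeAlert
  omega

theorem weight_passAlert {c : Config n L} {u v : Fin n} (hu : (c.state u).HasAlert) (huv : u ≠ v) :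
    (c.passAlert u v).weight = c.weight := by
  unfold Config.passAlert
  split_ifs with h
  · have h1 := c.weight_setState_add u (c.state u).dropAlert
    have h2 := (c.setState u (c.state u).dropAlert).weight_setState_add v (c.state v).addAlert
    have h3 := AgentState.weight_dropAlert hu
    have h4 : (c.setState u (c.state u).dropAlert).state v = c.state v := by
      simp [Config.setState, huv.symm]
    have h5 : (c.state v).addAlert.weight = (c.state v).weight + 1 := by
      rcases h with h | h <;> simp [h, AgentState.addAlert, AgentState.weight]
    rw [h4] at h2
    omega
  · rfl

theorem weight_moveTo (c : Config n L) (u : Fin n) (ℓ : Site L) :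
    (c.moveTo u ℓ).weight = c.weight := by
  simp [weight, moveTo_state]

/-- The broadcaster drops to weight 0, and every other affected agent was Aware, so replacing its
state by the all-clear state of weight 1 gains nothing. -/
theorem weight_broadcastClear_lt {c : Config n L} {u : Fin n} (hu : (c.state u).IsAware) :
    (c.broadcastClear u).weight < c.weight := by
  have pos : ∀ s : AgentState, s.IsAware → 1 ≤ s.weight := by
    intro s hs
    cases s <;> simp_all [AgentState.IsAware, AgentState.weight]
  refine Finset.sum_lt_sum (fun v _ => ?_) ⟨u, Finset.mem_univ u, ?_⟩
  · simp only [Config.broadcastClear]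
    split_ifs with h1 h2
    · simp [AgentState.weight]
    · exact pos _ h2.2
    · exact le_rfl
  · simp only [Config.broadcastClear, if_true, AgentState.weight]
    exact pos _ hu

end Config

/-! ### Possible outcomes of one iteration -/

theorem chance_apply {α : Type*} (r : ℝ) (a b : PMF α) (y : α) :
    chance r a b y = coin r true * a y + coin r false * b y := by
  simp [chance, PMF.bind_apply, tsum_fintype]

theorem coin_half (b : Bool) : coin (1 / 2) b = 2⁻¹ := by
  have h : ENNReal.ofReal (1 / 2) = 2⁻¹ := by
    rw [one_div, ENNReal.ofReal_inv_of_pos two_pos]; simp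
  cases b <;> simp [coin, PMF.ofFintype_apply, -one_div, h]

theorem chance_half_apply {α : Type*} (a b : PMF α) (y : α) :
    chance (1 / 2) a b y = 2⁻¹ * a y + 2⁻¹ * b y := by
  rw [chance_apply, coin_half, coin_half]

theorem mem_support_chance {α : Type*} {r : ℝ} {a b : PMF α} {y : α}
    (hy : y ∈ (chance r a b).support) : y ∈ a.support ∨ y ∈ b.support := by
  rw [PMF.mem_support_iff, chance_apply] at hy
  simp only [PMF.mem_support_iff]
  by_contra! h
  simp [h.1, h.2] at hy

section Kernel

variable {n L : ℕ} {p lam : ℝ} {Δ : ℕ} {χ : AlertChoice n L} {F : Finset (Site L)}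
  {c y : Config n L}

/-- The outcomes that create flags or tokens retain `c.pos u ∈ F`, so they disappear when there is
no food. -/
theorem mem_support_adaptiveStimuli {u : Fin n}
    (hy : y ∈ (adaptiveStimuli p Δ χ F c u).support) :
    y = c ∨ (c.pos u ∈ F ∧ (y = c.setState u .awareW ∨ y = c.setState u .awareAW)) ∨
      ((c.state u).IsImmobile ∧ y = c.broadcastClear u) ∨
      (c.state u = .unaware ∧ ∃ v ∈ c.alertNbrs u, y = c.consumeAlert u v) ∨
      ((c.state u).HasAlert ∧ ∃ v ∈ c.nbrs u, y = c.passAlert u v) := by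
  have pass : ∀ h : (c.nbrs u).Nonempty, y ∈ (chance (((c.nbrs u).card : ℝ) / Δ)
      ((PMF.uniformOfFinset (c.nbrs u) h).map (c.passAlert u)) (PMF.pure c)).support →
      y = c ∨ ∃ v ∈ c.nbrs u, y = c.passAlert u v := by
    intro h hy
    rcases mem_support_chance hy with hy | hy
    · rw [PMF.mem_support_map_iff] at hy
      obtain ⟨v, hv, rfl⟩ := hy
      exact Or.inr ⟨v, (PMF.mem_support_uniformOfFinset_iff h v).1 hv, rfl⟩
    · exact Or.inl (by simpa using hy)
  unfold adaptiveStimuli at hy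
  by_cases h1 : c.pos u ∈ F ∧ ¬ (c.state u).HasWitnessFlag
  · rw [if_pos h1] at hy
    rcases mem_support_chance hy with hy | hy
    · exact Or.inr (Or.inl ⟨h1.1, Or.inl (by simpa using hy)⟩)
    · exact Or.inl (by simpa using hy)
  rw [if_neg h1] at hy
  by_cases h2 : c.pos u ∉ F ∧ (c.state u).HasWitnessFlag
  · rw [if_pos h2] at hy
    refine Or.inr (Or.inr (Or.inl ⟨?_, by simpa using hy⟩))
    rcases h2.2 with h | h <;> simp [h, AgentState.IsImmobile]
  · rw [if_neg h2] at hy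
    split at hy
    next hs =>
      split_ifs at hy with h
      · rw [PMF.mem_support_map_iff] at hy
        obtain ⟨v, hv, rfl⟩ := hy
        exact Or.inr (Or.inr (Or.inr (Or.inl ⟨hs, v, χ.mem_alertNbrs c u h v hv, rfl⟩)))
      · exact Or.inl (by simpa using hy)
    next => exact Or.inl (by simpa using hy)
    next hs =>
      split_ifs at hy with h
      · rcases pass h hy with h | h
        · exact Or.inl h
        · exact Or.inr (Or.inr (Or.inr (Or.inr ⟨Or.inl hs, h⟩)))
      · exact Or.inl (by simpa using hy)
    next hs =>
      split_ifs at hy with h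
      · rcases pass h hy with h | h
        · exact Or.inl h
        · exact Or.inr (Or.inr (Or.inr (Or.inr ⟨Or.inr hs, h⟩)))
      · exact Or.inl (by simpa using hy)
    next hs =>
      have hF : c.pos u ∈ F := by
        by_contra hF
        exact h2 ⟨hF, Or.inl hs⟩
      rcases mem_support_chance hy with hy | hy
      · exact Or.inr (Or.inl ⟨hF, Or.inr (by simpa using hy)⟩)
      · exact Or.inl (by simpa using hy)
    next hs =>
      exact Or.inr (Or.inr (Or.inl ⟨by simp [hs, AgentState.IsImmobile], by simpa using hy⟩))

theorem mem_support_executeMove {u : Fin n} (hy : y ∈ (executeMove lam F c u).support) :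
    y = c ∨ ∃ ℓ, y = c.moveTo u ℓ ∧ (¬ (c.state u).IsAware ∨
      ((c.state u).IsAware ∧ ¬ (c.state u).IsImmobile ∧ c.ValidCompressionMove u ℓ)) := by
  unfold executeMove at hy
  split_ifs at hy with h1 h2
  · exact Or.inl (by simpa using hy)
  · rw [executeGather, PMF.mem_support_bind_iff] at hy
    obtain ⟨d, -, hy⟩ := hy
    dsimp only at hy
    split_ifs at hy with hv
    · rcases mem_support_chance hy with hy | hy
      · exact Or.inr ⟨_, by simpa using hy, Or.inr ⟨h2, fun h => h1 (Or.inr h), hv⟩⟩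
      · exact Or.inl (by simpa using hy)
    · exact Or.inl (by simpa using hy)
  · rw [executeSearch, PMF.mem_support_map_iff] at hy
    obtain ⟨d, -, rfl⟩ := hy
    exact Or.inr ⟨_, rfl, Or.inl h2⟩

variable [NeZero n]

theorem mem_support_compressionStep (hy : y ∈ (compressionStep p lam Δ χ F c).support) :
    ∃ u, y ∈ (adaptiveStimuli p Δ χ F c u).support ∨ y ∈ (executeMove lam F c u).support := by
  rw [compressionStep, PMF.mem_support_bind_iff] at hy
  obtain ⟨u, -, hy⟩ := hy
  exact ⟨u, mem_support_chance hy⟩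

theorem Config.StateInvariant.compressionStep (hc : c.StateInvariant)
    (hy : y ∈ (compressionStep p lam Δ χ F c).support) : y.StateInvariant := by
  obtain ⟨u, hy | hy⟩ := mem_support_compressionStep hy
  · rcases mem_support_adaptiveStimuli hy with rfl | ⟨-, rfl | rfl⟩ | ⟨-, rfl⟩ |
      ⟨hu, v, hv, rfl⟩ | ⟨hu, v, hv, rfl⟩
    · exact hc
    · exact hc.setState (by simp [AgentState.IsAware]) (by simp [AgentState.IsImmobile])
        (by simp [AgentState.IsImmobile])
    · exact hc.setState (by simp [AgentState.IsAware]) (by simp [AgentState.IsImmobile])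
        (by simp [AgentState.IsImmobile])
    · exact hc.broadcastClear u
    · exact hc.consumeAlert hu hv
    · exact hc.passAlert hu.isAware
  · rcases mem_support_executeMove hy with rfl | ⟨ℓ, rfl, h | ⟨h1, h2, h3⟩⟩
    · exact hc
    · exact hc.moveTo_of_not_isAware h ℓ
    · exact hc.moveTo_of_valid h1 h2 h3

/-- The food set enters only through whether the activated agent stands on it. Without witnesses the
adversary therefore has no influence and the law is time-homogeneous. -/
theorem compressionStep_eq_of_witnesses_eq_empty (h : c.witnesses F = ∅) :
    compressionStep p lam Δ χ F c = compressionStep p lam Δ χ ∅ c := by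
  have h' : ∀ u, c.pos u ∉ F := by
    intro u hu
    have : u ∈ c.witnesses F := by simpa [Config.witnesses] using hu
    simp [h] at this
  refine congrArg _ (funext fun u => ?_)
  congr 1
  · by_cases hw : (c.state u).HasWitnessFlag <;> simp [adaptiveStimuli, h' u, hw]
  · by_cases hw : (c.state u).IsImmobile <;> simp [executeMove, h' u, hw]

theorem weight_le_of_mem_support (hy : y ∈ (compressionStep p lam Δ χ ∅ c).support) :
    y.weight ≤ c.weight := by
  obtain ⟨u, hy | hy⟩ := mem_support_compressionStep hy
  · rcases mem_support_adaptiveStimuli hy with rfl | ⟨h, -⟩ | ⟨hu, rfl⟩ |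
      ⟨hu, v, hv, rfl⟩ | ⟨hu, v, hv, rfl⟩
    · exact le_rfl
    · simp at h
    · exact (Config.weight_broadcastClear_lt hu.isAware).le
    · exact (Config.weight_consumeAlert hu hv).le
    · exact (Config.weight_passAlert hu (Config.mem_nbrs.1 hv).ne).le
  · rcases mem_support_executeMove hy with rfl | ⟨ℓ, rfl, -⟩
    · exact le_rfl
    · exact (c.weight_moveTo u ℓ).le

omit [NeZero n] in
theorem weight_eq_zero_iff : c.weight = 0 ↔ c.AllUnaware := by
  simp only [Config.weight, Finset.sum_eq_zero_iff, Finset.mem_univ, true_imp_iff,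
    Config.AllUnaware]
  refine forall_congr' fun u => ?_
  cases c.state u <;> simp [AgentState.weight]

theorem Config.AllUnaware.of_mem_support (hc : c.AllUnaware)
    (hy : y ∈ (compressionStep p lam Δ χ ∅ c).support) : y.AllUnaware := by
  rw [← weight_eq_zero_iff] at hc ⊢
  have := weight_le_of_mem_support hy
  omega

theorem le_compressionStep (p lam : ℝ) (Δ : ℕ) (χ : AlertChoice n L) (F : Finset (Site L))
    (c y : Config n L) (u : Fin n) :
    (n : ℝ≥0∞)⁻¹ * (2⁻¹ * adaptiveStimuli p Δ χ F c u y + 2⁻¹ * executeMove lam F c u y) ≤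
      compressionStep p lam Δ χ F c y := by
  rw [compressionStep, PMF.bind_apply]
  refine le_trans ?_ (ENNReal.le_tsum u)
  rw [chance_half_apply, PMF.uniformOfFintype_apply, Fintype.card_fin]

/-- The invariant provides an immobile agent. Without food its state update is a certain broadcast,
because of its witness flag or its all-clear token; it is chosen with probability `1 / n`, and a
state update with probability `1 / 2`. -/
theorem exists_weight_lt (hc : c.StateInvariant) (hc' : ¬ c.AllUnaware) :
    ∃ y : Config n L, y.weight < c.weight ∧
      (2 * (n : ℝ≥0∞))⁻¹ ≤ compressionStep p lam Δ χ ∅ c y := by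
  obtain ⟨u, hu⟩ : ∃ u, (c.state u).IsAware := by
    simpa [Config.AllUnaware, AgentState.IsAware] using hc'
  obtain ⟨v, -, hv⟩ := hc u hu
  refine ⟨c.broadcastClear v, Config.weight_broadcastClear_lt hv.isAware, ?_⟩
  refine le_trans ?_ (le_compressionStep p lam Δ χ ∅ c _ v)
  have : adaptiveStimuli p Δ χ ∅ c v = PMF.pure (c.broadcastClear v) := by
    rcases hv with h | h | h <;> simp [adaptiveStimuli, h, AgentState.HasWitnessFlag]
  rw [this, ENNReal.mul_inv (by simp) (by simp), mul_comm]
  gcongr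
  simp

end Kernel

/-! ### Connectivity of the lattice -/

theorem latticeDir_add_one (L : ℕ) (d : Fin 6) :
    latticeDir L (d + 1) = latticeDir L d + latticeDir L (d + 2) := by
  fin_cases d <;> simp [latticeDir]

theorem latticeDir_add_three (L : ℕ) (d : Fin 6) :
    latticeDir L (d + 3) = -latticeDir L d := by
  fin_cases d <;> simp [latticeDir]

theorem reachable_add_latticeDir {L : ℕ} (s : Site L) (d : Fin 6) :
    (latticeGraph L).Reachable s (s + latticeDir L d) := by
  by_cases h : s = s + latticeDir L d
  · rw [← h]
  · exact SimpleGraph.Adj.reachable ⟨h, d, rfl⟩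

theorem latticeGraph_preconnected (L : ℕ) [NeZero L] : (latticeGraph L).Preconnected := by
  have key : ∀ (d : Fin 6) (k : ℕ) (s : Site L),
      (latticeGraph L).Reachable s (s + k • latticeDir L d) := by
    intro d k
    induction k with
    | zero => intro s; simp
    | succ k ih =>
      intro s
      rw [succ_nsmul, ← add_assoc]
      exact (ih s).trans (reachable_add_latticeDir _ d)
  intro x y
  have h := (key 0 (y - x).1.val x).trans (key 1 (y - x).2.val _)
  convert h
  ext <;> simp [latticeDir]

section Exclusion

variable {n L : ℕ}

/-! ### Simple exclusion of Unaware agents -/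

/-- All agents are Unaware and placed according to `x`. -/
def unawareAt (x : Fin n ↪ Site L) : Config n L := ⟨x, fun _ => .unaware⟩

/-- Agent `u` moves one step in direction `d` if the target is free. -/
def hop (x : Fin n ↪ Site L) (u : Fin n) (d : Fin 6) : Fin n ↪ Site L :=
  ((unawareAt x).moveTo u (x u + latticeDir L d)).pos

theorem unawareAt_injective : Function.Injective (unawareAt : (Fin n ↪ Site L) → Config n L) :=
  fun _ _ h => congrArg Config.pos h

theorem Config.AllUnaware.eq_unawareAt {c : Config n L} (hc : c.AllUnaware) :
    c = unawareAt c.pos := by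
  ext1
  · rfl
  · exact funext hc

theorem allUnaware_unawareAt (x : Fin n ↪ Site L) : (unawareAt x).AllUnaware := fun _ => rfl

theorem moveTo_unawareAt (x : Fin n ↪ Site L) (u : Fin n) (d : Fin 6) :
    (unawareAt x).moveTo u (x u + latticeDir L d) = unawareAt (hop x u d) := by
  refine Config.AllUnaware.eq_unawareAt fun v => ?_
  rw [Config.moveTo_state]
  rfl

theorem hop_eq_self {x : Fin n ↪ Site L} {u : Fin n} {d : Fin 6}
    (h : ∃ v, x v = x u + latticeDir L d) : hop x u d = x := by
  obtain ⟨v, hv⟩ := h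
  rw [hop, Config.moveTo, dif_neg]
  · rfl
  · exact fun h => h v hv

theorem hop_apply_self {x : Fin n ↪ Site L} {u : Fin n} {d : Fin 6}
    (h : ∀ v, x v ≠ x u + latticeDir L d) : hop x u d u = x u + latticeDir L d :=
  Config.moveTo_pos_self (c := unawareAt x) u h

theorem hop_apply_of_ne (x : Fin n ↪ Site L) {u v : Fin n} (hv : v ≠ u) (d : Fin 6) :
    hop x u d v = x v :=
  Config.moveTo_pos_of_ne _ hv _

/-- A hop that changes the placement vacates its starting site, so the opposite direction `d + 3`
leads back to a free site. -/
theorem hop_reverse {x y : Fin n ↪ Site L} {u : Fin n} {d : Fin 6} (h : hop x u d = y)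
    (hxy : x ≠ y) : hop y u (d + 3) = x := by
  have hfree : ∀ v, x v ≠ x u + latticeDir L d := by
    by_contra! hv
    exact hxy ((hop_eq_self hv).symm.trans h)
  have hu : y u = x u + latticeDir L d := by rw [← h, hop_apply_self hfree]
  have hv : ∀ v, v ≠ u → y v = x v := fun v hv => by rw [← h, hop_apply_of_ne x hv]
  have hback : y u + latticeDir L (d + 3) = x u := by rw [hu, latticeDir_add_three]; simp
  have hfree' : ∀ v, y v ≠ y u + latticeDir L (d + 3) := by
    intro v
    rw [hback]
    by_cases hvu : v = u
    · rw [hvu, hu]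
      exact (hfree u).symm
    · rw [hv v hvu]
      exact fun h => hvu (x.injective h)
  ext1 v
  by_cases hvu : v = u
  · rw [hvu, hop_apply_self hfree', hback]
  · rw [hop_apply_of_ne y hvu, hv v hvu]

/-- `y` can be reached from `x` by exclusion moves. -/
def HopConnected (x y : Fin n ↪ Site L) : Prop :=
  Relation.ReflTransGen (fun a b => ∃ u d, hop a u d = b) x y

theorem HopConnected.trans {x y z : Fin n ↪ Site L} (h : HopConnected x y)
    (h' : HopConnected y z) : HopConnected x z := Relation.ReflTransGen.trans h h'

theorem HopConnected.symm {x y : Fin n ↪ Site L} (h : HopConnected x y) : HopConnected y x := by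
  induction h with
  | refl => exact Relation.ReflTransGen.refl
  | @tail a b _ hab ih =>
    refine Relation.ReflTransGen.head ?_ ih
    obtain ⟨u, d, hab⟩ := hab
    by_cases h : a = b
    · exact ⟨u, d, by rw [← h] at hab ⊢; exact hab⟩
    · exact ⟨u, d + 3, hop_reverse hab h⟩

/-- Rearrange a placement by a permutation of the sites. -/
def permute (σ : Equiv.Perm (Site L)) (x : Fin n ↪ Site L) : Fin n ↪ Site L :=
  x.trans σ.toEmbedding

theorem permute_apply (σ : Equiv.Perm (Site L)) (x : Fin n ↪ Site L) (v : Fin n) :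
    permute σ x v = σ (x v) := rfl

theorem permute_mul (σ τ : Equiv.Perm (Site L)) (x : Fin n ↪ Site L) :
    permute (σ * τ) x = permute σ (permute τ x) := rfl

theorem hopConnected_swap_of_free_right {x : Fin n ↪ Site L} {a b : Site L}
    (hab : (latticeGraph L).Adj a b) (hb : ∀ v, x v ≠ b) :
    HopConnected x (permute (Equiv.swap a b) x) := by
  by_cases ha : ∃ u, x u = a
  · obtain ⟨u, rfl⟩ := ha
    obtain ⟨d, rfl⟩ := hab.2
    refine Relation.ReflTransGen.single ⟨u, d, ?_⟩
    ext1 v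
    by_cases hv : v = u
    · rw [hv, hop_apply_self hb, permute_apply, Equiv.swap_apply_left]
    · rw [hop_apply_of_ne x hv, permute_apply,
        Equiv.swap_apply_of_ne_of_ne (fun h => hv (x.injective h)) (hb v)]
  · push Not at ha
    have : permute (Equiv.swap a b) x = x := by
      ext1 v
      rw [permute_apply, Equiv.swap_apply_of_ne_of_ne (ha v) (hb v)]
    rw [this]
    exact Relation.ReflTransGen.refl

theorem hopConnected_swap_of_free_left {x : Fin n ↪ Site L} {a b : Site L}
    (hab : (latticeGraph L).Adj a b) (ha : ∀ v, x v ≠ a) :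
    HopConnected x (permute (Equiv.swap a b) x) := by
  rw [Equiv.swap_comm]
  exact hopConnected_swap_of_free_right hab.symm ha

/-- The agents on `a` and `b` can be exchanged, all others staying in place, whenever `h` is
free. -/
def Exchangeable (n : ℕ) (a b h : Site L) : Prop :=
  ∀ x : Fin n ↪ Site L, (∀ v, x v ≠ h) → HopConnected x (permute (Equiv.swap a b) x)

theorem Exchangeable.symm {a b h : Site L} (H : Exchangeable n a b h) : Exchangeable n b a h := by
  rwa [Exchangeable, Equiv.swap_comm]

theorem free_permute_swap {x : Fin n ↪ Site L} {a b s t : Site L} (ht : ∀ v, x v ≠ t)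
    (hst : Equiv.swap a b t = s) (v : Fin n) : permute (Equiv.swap a b) x v ≠ s := by
  rw [permute_apply, ← hst]
  exact fun h => ht v ((Equiv.swap a b).injective h)

/-- Around the triangle, the agent at `a` steps to `h`, the agent at `b` to `a`, and the first one
on to `b`; the hole ends where it began. -/
theorem exchangeable_of_triangle {a b h : Site L} (hab : (latticeGraph L).Adj a b)
    (hah : (latticeGraph L).Adj a h) (hbh : (latticeGraph L).Adj b h) :
    Exchangeable n a b h := by
  intro x hx
  have h1 : ∀ v, permute (Equiv.swap h a) x v ≠ a :=
    free_permute_swap hx (Equiv.swap_apply_left _ _)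
  have h2 : ∀ v, permute (Equiv.swap a b) (permute (Equiv.swap h a) x) v ≠ b :=
    free_permute_swap h1 (Equiv.swap_apply_left _ _)
  have key := ((hopConnected_swap_of_free_left hah.symm hx).trans
    (hopConnected_swap_of_free_left hab h1)).trans (hopConnected_swap_of_free_left hbh h2)
  convert key using 1
  rw [← permute_mul, ← permute_mul]
  congr 1
  rw [Equiv.mul_swap_eq_swap_mul, Equiv.Perm.mul_apply, Equiv.Perm.mul_apply,
    Equiv.swap_apply_of_ne_of_ne hah.ne' hbh.ne', Equiv.swap_apply_right, Equiv.swap_apply_left,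
    Equiv.swap_apply_left, ← mul_assoc, Equiv.swap_mul_self, one_mul]

/-- Conjugation: shift the hole from `h` to `c`, exchange, shift it back. The two transpositions are
disjoint, hence commute, so the shift leaves no trace. -/
theorem Exchangeable.of_adj {a b h c : Site L} (H : Exchangeable n a b c)
    (hhc : (latticeGraph L).Adj h c) (hh : h ≠ a ∧ h ≠ b) (hc : c ≠ a ∧ c ≠ b) :
    Exchangeable n a b h := by
  intro x hx
  have hcomm : Equiv.swap a b * Equiv.swap h c = Equiv.swap h c * Equiv.swap a b :=
    by rw [Equiv.mul_swap_eq_swap_mul, Equiv.swap_apply_of_ne_of_ne hh.1 hh.2,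
      Equiv.swap_apply_of_ne_of_ne hc.1 hc.2]
  have h1 := (hopConnected_swap_of_free_left hhc hx).trans
    (H _ (free_permute_swap hx (Equiv.swap_apply_left _ _)))
  rw [← permute_mul, hcomm, permute_mul] at h1
  refine h1.trans (hopConnected_swap_of_free_left hhc ?_).symm
  exact free_permute_swap hx (Equiv.swap_apply_of_ne_of_ne hh.1 hh.2)

/-- Of the six neighbours of `a`, those in directions `d + 1` and `d + 5` form triangles with `a`
and `b = a + d`; a hole at `d + 2`, `d + 3` or `d + 4` walks around the ring to one of them. On
small tori these sites may coincide, hence the care with inequalities. -/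
theorem exchangeable_of_adj_left {a b h : Site L} (hab : (latticeGraph L).Adj a b)
    (hah : (latticeGraph L).Adj a h) (hhb : h ≠ b) : Exchangeable n a b h := by
  -- On the one-site torus there are no edges, so `hab` rules out `L = 1`.
  have hL : (1 : ZMod L) ≠ 0 := by
    intro h1
    have : ∀ z : ZMod L, z = 0 := fun z => by rw [← mul_one z, h1, mul_zero]
    exact hab.ne (Prod.ext ((this _).trans (this _).symm) ((this _).trans (this _).symm))
  have dir_ne : ∀ d, latticeDir L d ≠ 0 := by
    intro d hd
    fin_cases d <;> simp [latticeDir, hL] at hd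
  have dir_ne' : ∀ d, latticeDir L (d + 2) ≠ latticeDir L d := by
    intro d hd
    fin_cases d <;> simp [latticeDir, hL] at hd
    exact hL hd.1.symm
  have adj : ∀ s k, (latticeGraph L).Adj s (s + latticeDir L k) := fun s k =>
    ⟨by simpa using dir_ne k, k, rfl⟩
  obtain ⟨d, rfl⟩ := hab.2
  obtain ⟨k, rfl⟩ := hah.2
  have e1 := latticeDir_add_one L d
  have e2 := latticeDir_add_one L (d + 1)
  have e4 : latticeDir L (d + 5) = latticeDir L (d + 4) + latticeDir L d := by
    have := latticeDir_add_one L (d + 4)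
    simpa [add_assoc] using this
  have e5 : latticeDir L d = latticeDir L (d + 5) + latticeDir L (d + 1) := by
    have := latticeDir_add_one L (d + 5)
    simpa [add_assoc] using this
  have T1 : Exchangeable n a (a + latticeDir L d) (a + latticeDir L (d + 1)) := by
    refine exchangeable_of_triangle hab (adj _ _) ?_
    rw [e1, ← add_assoc]
    exact adj _ _
  have T5 : Exchangeable n a (a + latticeDir L d) (a + latticeDir L (d + 5)) := by
    refine exchangeable_of_triangle hab (adj _ _) ?_
    rw [e4, add_comm (latticeDir L (d + 4)), ← add_assoc]
    exact adj _ _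
  have T2 : a + latticeDir L (d + 2) ≠ a + latticeDir L d →
      Exchangeable n a (a + latticeDir L d) (a + latticeDir L (d + 2)) := by
    intro hne
    refine T1.of_adj (c := a + latticeDir L (d + 1)) ?_ ⟨(adj _ _).ne', hne⟩
      ⟨(adj _ _).ne', ?_⟩
    · rw [e1, add_comm (latticeDir L d), ← add_assoc]
      exact adj _ _
    · rw [e1, ← add_assoc]
      exact (adj _ _).ne'
  obtain ⟨j, rfl⟩ : ∃ j, k = d + j := ⟨k - d, by simp⟩
  fin_cases j
  · simp at hhb
  · exact T1
  · exact T2 hhb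
  · have hne : a + latticeDir L (d + 2) ≠ a + latticeDir L d := by simpa using dir_ne' d
    refine (T2 hne).of_adj ?_ ⟨(adj _ _).ne', hhb⟩ ⟨(adj _ _).ne', hne⟩
    have e2' : latticeDir L (d + 2) = latticeDir L (d + 3) + latticeDir L (d + 1) := by
      have h2 : d + 1 + 1 = d + 2 := by rw [add_assoc]; rfl
      have h3 : d + 1 + 2 = d + 3 := by rw [add_assoc]; rfl
      rw [h2, h3] at e2
      exact e2.trans (add_comm _ _)
    rw [e2', ← add_assoc]
    exact adj _ _
  · refine T5.of_adj ?_ ⟨(adj _ _).ne', hhb⟩ ⟨(adj _ _).ne', ?_⟩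
    · rw [e4, ← add_assoc]
      exact adj _ _
    · intro h
      rw [add_right_inj] at h
      rw [h] at e5
      exact dir_ne (d + 1) (by simpa using e5)
  · exact T5

/-- The hole follows a walk towards `a` until the next site would be `a` or `b`; there the local
exchange applies. -/
theorem exchangeable_of_adj [NeZero L] {a b h : Site L} (hab : (latticeGraph L).Adj a b)
    (ha : h ≠ a) (hb : h ≠ b) : Exchangeable n a b h := by
  obtain ⟨p⟩ := latticeGraph_preconnected L h a
  induction p with
  | nil => exact absurd rfl ha
  | @cons h c a hhc p ih =>
    by_cases hca : c = a
    · subst hca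
      exact exchangeable_of_adj_left hab hhc.symm hb
    by_cases hcb : c = b
    · subst hcb
      exact (exchangeable_of_adj_left hab.symm hhc.symm ha).symm
    exact (ih hab hca hcb).of_adj hhc ⟨ha, hb⟩ ⟨hca, hcb⟩

theorem hopConnected_of_lt [NeZero L] (hn : n < L ^ 2) (x y : Fin n ↪ Site L) :
    HopConnected x y := by
  -- Quantifying over all placements makes the realizable site permutations closed under
  -- composition.
  let M : Submonoid (Equiv.Perm (Site L)) :=
    { carrier := {σ | ∀ x : Fin n ↪ Site L, HopConnected x (permute σ x)}
      one_mem' := fun x => Relation.ReflTransGen.refl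
      mul_mem' := fun {σ τ} hσ hτ x => (hτ x).trans (hσ _) }
  have hadj : ∀ a b, (latticeGraph L).Adj a b → Equiv.swap a b ∈ M := by
    intro a b hab x
    obtain ⟨h, hh⟩ : ∃ h, ∀ v, x v ≠ h := by
      by_contra! hsurj
      have := Fintype.card_le_of_surjective x hsurj
      simp [ZMod.card] at this
      nlinarith
    by_cases ha : h = a
    · exact hopConnected_swap_of_free_left hab (ha ▸ hh)
    by_cases hb : h = b
    · exact hopConnected_swap_of_free_right hab (hb ▸ hh)
    exact exchangeable_of_adj hab ha hb x hh
  have hswap : ∀ a b, Equiv.swap a b ∈ M := by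
    intro a b
    obtain ⟨p⟩ := latticeGraph_preconnected L a b
    induction p with
    | nil => rw [Equiv.swap_self]; exact M.one_mem
    | cons h p ih => exact SubmonoidClass.swap_mem_trans _ (hadj _ _ h) ih
  have htop : M = ⊤ := by
    rw [eq_top_iff, ← Equiv.Perm.mclosure_isSwap, Submonoid.closure_le]
    rintro σ ⟨a, b, -, rfl⟩
    exact hswap a b
  obtain ⟨σ, rfl⟩ : ∃ σ, permute σ x = y := by
    let e : {s // s ∈ Set.range x} ≃ {s // s ∈ Set.range y} :=
      (Equiv.ofInjective x x.injective).symm.trans (Equiv.ofInjective y y.injective)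
    refine ⟨e.extendSubtype, ?_⟩
    ext1 v
    rw [permute_apply, Equiv.extendSubtype_apply_of_mem e (x v) ⟨v, rfl⟩]
    simp [e]
  have : σ ∈ M := htop ▸ Submonoid.mem_top σ
  exact this x

end Exclusion

/-! ### Convergence of doubly stochastic chains -/

section Doeblin

variable {E : Type*} [Fintype E] [DecidableEq E]

/-- A doubly stochastic matrix with entries at least `ε` contracts the `ℓ¹` norm of vectors with
zero sum. -/
theorem sum_abs_vecMul_le {A : Matrix E E ℝ} (hA : A ∈ doublyStochastic ℝ E) {ε : ℝ}
    (hε : ∀ x y, ε ≤ A x y) {v : E → ℝ} (hv : ∑ x, v x = 0) :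
    ∑ y, |∑ x, v x * A x y| ≤ (1 - Fintype.card E * ε) * ∑ x, |v x| := by
  have h1 : ∀ y, |∑ x, v x * A x y| ≤ ∑ x, |v x| * (A x y - ε) := by
    intro y
    -- As `v` has zero sum, subtracting `ε` from every entry is free; the reduced entries stay
    -- nonnegative and their row sums are `1 - card E * ε`.
    have : ∑ x, v x * A x y = ∑ x, v x * (A x y - ε) := by
      simp only [mul_sub, Finset.sum_sub_distrib, ← Finset.sum_mul, hv, zero_mul, sub_zero]
    rw [this]
    refine (Finset.abs_sum_le_sum_abs _ _).trans (Finset.sum_le_sum fun x _ => ?_)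
    rw [abs_mul, abs_of_nonneg (sub_nonneg.2 (hε x y))]
  refine (Finset.sum_le_sum fun y _ => h1 y).trans (le_of_eq ?_)
  rw [Finset.sum_comm, Finset.mul_sum]
  refine Finset.sum_congr rfl fun x _ => ?_
  rw [← Finset.mul_sum, Finset.sum_sub_distrib, sum_row_of_mem_doublyStochastic hA]
  simp [mul_comm]

variable {P : Matrix E E ℝ}

theorem pow_succ_apply_pos (hP : P ∈ doublyStochastic ℝ E) {k : ℕ} {x y z : E}
    (h : 0 < (P ^ k) x y) (h' : 0 < P y z) : 0 < (P ^ (k + 1)) x z := by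
  rw [pow_succ, Matrix.mul_apply]
  refine Finset.sum_pos' (fun w _ => mul_nonneg ?_ ?_) ⟨y, Finset.mem_univ y, mul_pos h h'⟩
  · exact nonneg_of_mem_doublyStochastic (pow_mem hP k)
  · exact nonneg_of_mem_doublyStochastic hP

/-- Positive diagonal entries let a path wait, so positivity persists for larger exponents and one
exponent serves all pairs. -/
theorem exists_forall_pow_pos (hP : P ∈ doublyStochastic ℝ E) (diag : ∀ x, 0 < P x x)
    (irred : ∀ x y, Relation.ReflTransGen (fun a b => 0 < P a b) x y) :
    ∃ m, m ≠ 0 ∧ ∀ x y, 0 < (P ^ m) x y := by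
  have h1 : ∀ x y, ∃ k, 0 < (P ^ k) x y := by
    intro x y
    induction irred x y with
    | refl => exact ⟨0, by simp⟩
    | tail _ h ih =>
      obtain ⟨k, hk⟩ := ih
      exact ⟨k + 1, pow_succ_apply_pos hP hk h⟩
  choose k hk using h1
  have mono : ∀ x y m m', m ≤ m' → 0 < (P ^ m) x y → 0 < (P ^ m') x y := by
    intro x y m m' hm h
    induction hm with
    | refl => exact h
    | step _ ih => exact pow_succ_apply_pos hP ih (diag y)
  -- The extra 1 keeps the exponent nonzero, as needed for dividing time into blocks of this length.
  refine ⟨Finset.univ.sup (fun q : E × E => k q.1 q.2) + 1, by omega, fun x y => ?_⟩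
  refine mono x y _ _ (le_trans ?_ (Nat.le_succ _)) (hk x y)
  exact Finset.le_sup (f := fun q : E × E => k q.1 q.2) (Finset.mem_univ (x, y))

/-- The powers of an irreducible doubly stochastic matrix with positive diagonal converge to the
uniform matrix. -/
theorem tendsto_pow_doublyStochastic (hP : P ∈ doublyStochastic ℝ E) (diag : ∀ x, 0 < P x x)
    (irred : ∀ x y, Relation.ReflTransGen (fun a b => 0 < P a b) x y) (x y : E) :
    Tendsto (fun k => (P ^ k) x y) atTop (𝓝 (Fintype.card E : ℝ)⁻¹) := by
  obtain ⟨m, hm0, hm⟩ := exists_forall_pow_pos hP diag irred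
  obtain ⟨q, -, hq⟩ := Finset.exists_min_image (Finset.univ : Finset (E × E))
    (fun q => (P ^ m) q.1 q.2) ⟨(x, x), Finset.mem_univ _⟩
  set N : ℝ := (Fintype.card E : ℝ) with hN
  have hN0 : 0 < N := Nat.cast_pos.2 (Fintype.card_pos_iff.2 ⟨x⟩)
  set ε := (P ^ m) q.1 q.2
  have hε0 : 0 < ε := hm _ _
  have hε : ∀ a b, ε ≤ (P ^ m) a b := fun a b => hq (a, b) (Finset.mem_univ _)
  set r := 1 - N * ε with hr
  have hr1 : r < 1 := by rw [hr]; linarith [mul_pos hN0 hε0]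
  have hr0 : 0 ≤ r := by
    have := Finset.sum_le_sum fun b (_ : b ∈ Finset.univ) => hε x b
    rw [sum_row_of_mem_doublyStochastic (pow_mem hP m)] at this
    simp only [Finset.sum_const, Finset.card_univ, nsmul_eq_mul] at this
    rw [hr]; linarith
  let v : ℕ → E → ℝ := fun k b => (P ^ k) x b - N⁻¹
  have hv0 : ∀ k, ∑ b, v k b = 0 := by
    intro k
    simp only [v, Finset.sum_sub_distrib, sum_row_of_mem_doublyStochastic (pow_mem hP k)]
    simp [← hN, hN0.ne']
  have hvadd : ∀ k j b, v (k + j) b = ∑ a, v k a * (P ^ j) a b := by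
    intro k j b
    simp only [v, sub_mul, Finset.sum_sub_distrib, ← Finset.mul_sum,
      sum_col_of_mem_doublyStochastic (pow_mem hP j), mul_one]
    rw [pow_add, Matrix.mul_apply]
  let D : ℕ → ℝ := fun k => ∑ b, |v k b|
  -- The contraction estimate with `ε = 0` gives monotonicity, which handles the times between
  -- multiples of `m`.
  have hD1 : ∀ k, D (k + 1) ≤ D k := by
    intro k
    have := sum_abs_vecMul_le (pow_mem hP 1) (ε := 0)
      (fun a b => nonneg_of_mem_doublyStochastic (pow_mem hP 1)) (hv0 k)
    simpa only [← hvadd, mul_zero, sub_zero, one_mul] using this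
  have hDm : ∀ k, D (k + m) ≤ r * D k := by
    intro k
    have := sum_abs_vecMul_le (pow_mem hP m) hε (hv0 k)
    simpa only [← hvadd] using this
  have hDanti : Antitone D := antitone_nat_of_succ_le hD1
  have hDpow : ∀ j, D (m * j) ≤ r ^ j * D 0 := by
    intro j
    induction j with
    | zero => simp
    | succ j ih =>
      rw [mul_add, mul_one, pow_succ']
      refine (hDm _).trans ?_
      rw [mul_assoc]
      exact mul_le_mul_of_nonneg_left ih hr0
  have hlim : Tendsto (fun k => r ^ (k / m) * D 0) atTop (𝓝 0) := by
    have := ((tendsto_pow_atTop_nhds_zero_of_lt_one hr0 hr1).comp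
      (Nat.tendsto_div_const_atTop hm0)).mul_const (D 0)
    simpa using this
  have hbound : ∀ k, |v k y| ≤ r ^ (k / m) * D 0 := fun k =>
    calc |v k y| ≤ D k := Finset.single_le_sum (f := fun b => |v k b|)
          (fun b _ => abs_nonneg _) (Finset.mem_univ y)
      _ ≤ D (m * (k / m)) := hDanti (Nat.mul_div_le k m)
      _ ≤ _ := hDpow _
  have hv : Tendsto (fun k => v k y) atTop (𝓝 0) := squeeze_zero_norm hbound hlim
  have := hv.add_const N⁻¹
  simpa [v] using this

end Doeblin

/-! ### The exclusion chain -/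

section ExclusionMatrix

variable {n L : ℕ} [NeZero n] [NeZero L]

/-- The transition probabilities of the placements once all agents are Unaware. -/
def exclusionKernel (x y : Fin n ↪ Site L) : ℝ≥0∞ :=
  ∑ u : Fin n, (n : ℝ≥0∞)⁻¹ * (2⁻¹ * (if y = x then 1 else 0) +
    2⁻¹ * ∑ d : Fin 6, 6⁻¹ * (if y = hop x u d then 1 else 0))

omit [NeZero L] in
-- With no tokens and no food a state update does nothing, so it only contributes laziness `1 / 2`.
theorem compressionStep_unawareAt (p lam : ℝ) (Δ : ℕ) (χ : AlertChoice n L)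
    (x y : Fin n ↪ Site L) :
    compressionStep p lam Δ χ ∅ (unawareAt x) (unawareAt y) = exclusionKernel x y := by
  have halert : ∀ u, (unawareAt x).alertNbrs u = ∅ := by
    intro u
    simp [Config.alertNbrs, unawareAt, AgentState.HasAlert]
  have hst : ∀ u, (unawareAt x).state u = .unaware := fun _ => rfl
  rw [compressionStep, PMF.bind_apply, tsum_fintype, exclusionKernel]
  refine Finset.sum_congr rfl fun u _ => ?_
  rw [chance_half_apply, PMF.uniformOfFintype_apply, Fintype.card_fin]
  have h1 : adaptiveStimuli p Δ χ ∅ (unawareAt x) u = PMF.pure (unawareAt x) := by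
    simp [adaptiveStimuli, hst, halert, AgentState.HasWitnessFlag]
  have h2 : executeMove lam ∅ (unawareAt x) u =
      (PMF.uniformOfFintype (Fin 6)).map fun d => unawareAt (hop x u d) := by
    simp only [← moveTo_unawareAt]
    simp [executeMove, AgentState.IsImmobile, AgentState.IsAware, executeSearch, unawareAt]
  rw [h1, h2, PMF.pure_apply, PMF.map_apply, tsum_fintype]
  simp only [unawareAt_injective.eq_iff, PMF.uniformOfFintype_apply, Fintype.card_fin, mul_ite,
    mul_one, mul_zero, Nat.cast_ofNat]

omit [NeZero L] [NeZero n] in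
theorem exclusionKernel_comm (x y : Fin n ↪ Site L) :
    exclusionKernel x y = exclusionKernel y x := by
  by_cases hxy : x = y
  · rw [hxy]
  refine Finset.sum_congr rfl fun u _ => ?_
  rw [if_neg hxy, if_neg (Ne.symm hxy)]
  congr 3
  refine Fintype.sum_equiv (Equiv.addRight 3) _ _ fun d => ?_
  have : y = hop x u d ↔ x = hop y u (d + 3) := by
    constructor
    · exact fun h => (hop_reverse h.symm hxy).symm
    · intro h
      have := hop_reverse h.symm (Ne.symm hxy)
      rw [add_assoc] at this
      simpa using this.symm
  simp only [this, Equiv.coe_addRight]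
  congr

theorem sum_exclusionKernel (x : Fin n ↪ Site L) : ∑ y, exclusionKernel x y = 1 := by
  have h6 : (6 : ℝ≥0∞) * 6⁻¹ = 1 := ENNReal.mul_inv_cancel (by simp) (by simp)
  have hn : (n : ℝ≥0∞) * (n : ℝ≥0∞)⁻¹ = 1 :=
    ENNReal.mul_inv_cancel (by simp [NeZero.ne n]) (by simp)
  simp only [exclusionKernel]
  rw [Finset.sum_comm]
  simp only [← Finset.mul_sum, Finset.sum_add_distrib]
  simp only [Finset.sum_ite_eq', Finset.mem_univ, if_true]
  simp only [Finset.sum_comm (s := (Finset.univ : Finset (Fin n ↪ Site L)))]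
  simp only [Finset.sum_ite_eq', Finset.mem_univ, if_true, Finset.sum_const, Finset.card_univ,
    Fintype.card_fin, nsmul_eq_mul, mul_one, Nat.cast_ofNat]
  calc _ = ((n : ℝ≥0∞) * (n : ℝ≥0∞)⁻¹) * (2⁻¹ + 2⁻¹ * (6 * 6⁻¹)) := by ring
    _ = 1 := by rw [hn, h6, mul_one, one_mul, ENNReal.inv_two_add_inv_two]

/-- The transition matrix of the exclusion chain. -/
def exclusionMatrix (n L : ℕ) : Matrix (Fin n ↪ Site L) (Fin n ↪ Site L) ℝ :=
  fun x y => (exclusionKernel x y).toReal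

theorem exclusionKernel_ne_top (x y : Fin n ↪ Site L) : exclusionKernel x y ≠ ∞ := by
  refine ne_top_of_le_ne_top ENNReal.one_ne_top ?_
  rw [← sum_exclusionKernel x]
  exact Finset.single_le_sum (f := fun y => exclusionKernel x y) (fun _ _ => zero_le)
    (Finset.mem_univ y)

theorem exclusionMatrix_mem : exclusionMatrix n L ∈ doublyStochastic ℝ (Fin n ↪ Site L) := by
  have row : ∀ x : Fin n ↪ Site L, ∑ y, exclusionMatrix n L x y = 1 := by
    intro x
    simp only [exclusionMatrix]
    rw [← ENNReal.toReal_sum fun y _ => exclusionKernel_ne_top x y, sum_exclusionKernel,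
      ENNReal.toReal_one]
  refine mem_doublyStochastic_iff_sum.2 ⟨fun x y => ENNReal.toReal_nonneg, row, fun y => ?_⟩
  simp only [exclusionMatrix, exclusionKernel_comm _ y]
  exact row y

theorem exclusionMatrix_pos {x y : Fin n ↪ Site L} (h : y = x ∨ ∃ u d, y = hop x u d) :
    0 < exclusionMatrix n L x y := by
  refine ENNReal.toReal_pos ?_ (exclusionKernel_ne_top x y)
  have hn : (n : ℝ≥0∞) ≠ ∞ := by simp
  rcases h with rfl | ⟨u, d, rfl⟩
  · simp [exclusionKernel, hn]
  · simp only [exclusionKernel, ne_eq, Finset.sum_eq_zero_iff, Finset.mem_univ, true_imp_iff,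
      not_forall]
    refine ⟨u, ?_⟩
    simp only [mul_eq_zero, add_eq_zero, Finset.sum_eq_zero_iff, not_or, not_and, not_forall]
    refine ⟨by simp, fun _ => ⟨by simp, d, Finset.mem_univ d, by simp⟩⟩

theorem tendsto_exclusionMatrix_pow (hn : n < L ^ 2) (x y : Fin n ↪ Site L) :
    Tendsto (fun k => (exclusionMatrix n L ^ k) x y) atTop
      (𝓝 (Fintype.card (Fin n ↪ Site L) : ℝ)⁻¹) := by
  refine tendsto_pow_doublyStochastic exclusionMatrix_mem
    (fun x => exclusionMatrix_pos (Or.inl rfl)) (fun x y => ?_) x y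
  refine Relation.ReflTransGen.mono ?_ x y (hopConnected_of_lt hn x y)
  rintro a b ⟨u, d, rfl⟩
  exact exclusionMatrix_pos (Or.inr ⟨u, d, rfl⟩)

end ExclusionMatrix

/-! ### Marginals of runs -/

instance {n L : ℕ} [NeZero L] : Finite (Config n L) :=
  Finite.of_injective (fun c : Config n L => (c.pos, c.state)) fun c c' h => by
    rw [Prod.mk.injEq] at h
    exact Config.ext h.1 h.2

instance {n L : ℕ} [NeZero L] : Fintype (Config n L) := Fintype.ofFinite _

/-- Only the fibres of `Y` need be measurable: `A` is arbitrary because the restricted measure is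
evaluated on the fibres. -/
theorem measure_eq_sum_fibers {Ω ι : Type*} [MeasurableSpace Ω] [Fintype ι] (μ : Measure Ω)
    (Y : Ω → ι) (hY : ∀ i, MeasurableSet {ω | Y ω = i}) (A : Set Ω) :
    μ A = ∑ i, μ {ω | Y ω = i ∧ ω ∈ A} := by
  have h : (⋃ i, {ω | Y ω = i}) = Set.univ := by ext ω; simp
  have := measure_iUnion (μ := μ.restrict A) (f := fun i => {ω | Y ω = i})
    (fun i j hij => Set.disjoint_left.2 fun ω h1 h2 => hij (h1.symm.trans h2)) hY
  rw [h, Measure.restrict_apply_univ, tsum_fintype] at this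
  rw [this]
  exact Finset.sum_congr rfl fun i _ => Measure.restrict_apply (hY i)

namespace IsRun

variable {n L : ℕ} [NeZero L] {Ω : Type*} [MeasurableSpace Ω] {μ : Measure Ω}
  {K : Finset (Site L) → Config n L → PMF (Config n L)}
  {X : ℕ → Ω → Config n L} {F : ℕ → Ω → Finset (Site L)}

/-- The defining identity of a run is summed over the finitely many histories that end in `(x, f)`.
-/
theorem measure_step (h : IsRun μ K X F) (t : ℕ) (x : Config n L) (f : Finset (Site L))
    (y : Config n L) :
    μ {ω | X t ω = x ∧ F t ω = f ∧ X (t + 1) ω = y} = μ {ω | X t ω = x ∧ F t ω = f} * K f x y := by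
  classical
  let Y : Ω → (Fin (t + 1) → Config n L × Finset (Site L)) := fun ω s => (X s ω, F s ω)
  -- A finite history is extended to all of `ℕ` by reducing the time modulo `t + 1`; only times `s ≤
  -- t` matter.
  let xs : (Fin (t + 1) → Config n L × Finset (Site L)) → ℕ → Config n L :=
    fun g s => (g (Fin.ofNat (t + 1) s)).1
  let fs : (Fin (t + 1) → Config n L × Finset (Site L)) → ℕ → Finset (Site L) :=
    fun g s => (g (Fin.ofNat (t + 1) s)).2
  have hYeq : ∀ g ω, Y ω = g ↔ ∀ s ≤ t, X s ω = xs g s ∧ F s ω = fs g s := by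
    intro g ω
    constructor
    · rintro rfl s hs
      have : s % (t + 1) = s := Nat.mod_eq_of_lt (by omega)
      simp [xs, fs, Y, this]
    · intro H
      funext s
      have := H s (by omega)
      ext1
      · simpa [xs, Y] using this.1
      · simpa [fs, Y] using this.2
  have hY : ∀ g, MeasurableSet {ω | Y ω = g} := by
    intro g
    have : {ω | Y ω = g} = ⋂ s : Fin (t + 1), {ω | X s ω = (g s).1} ∩ {ω | F s ω = (g s).2} := by
      ext ω
      simp [Y, funext_iff, Prod.ext_iff]
    rw [this]
    exact MeasurableSet.iInter fun s =>
      (h.measurableSet_config _ _).inter (h.measurableSet_food _ _)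
  rw [measure_eq_sum_fibers μ Y hY, measure_eq_sum_fibers μ Y hY {ω | X t ω = x ∧ F t ω = f},
    Finset.sum_mul]
  refine Finset.sum_congr rfl fun g _ => ?_
  by_cases hg : xs g t = x ∧ fs g t = f
  · have h1 : {ω | Y ω = g ∧ ω ∈ {ω | X t ω = x ∧ F t ω = f ∧ X (t + 1) ω = y}} =
        {ω | (∀ s ≤ t, X s ω = xs g s ∧ F s ω = fs g s) ∧ X (t + 1) ω = y} := by
      ext ω
      simp only [Set.mem_ofPred_eq, hYeq]
      constructor
      · exact fun H => ⟨H.1, H.2.2.2⟩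
      · exact fun H => ⟨H.1, (H.1 t le_rfl).1.trans hg.1, (H.1 t le_rfl).2.trans hg.2, H.2⟩
    have h2 : {ω | Y ω = g ∧ ω ∈ {ω | X t ω = x ∧ F t ω = f}} =
        {ω | ∀ s ≤ t, X s ω = xs g s ∧ F s ω = fs g s} := by
      ext ω
      simp only [Set.mem_ofPred_eq, hYeq]
      constructor
      · exact fun H => H.1
      · exact fun H => ⟨H, (H t le_rfl).1.trans hg.1, (H t le_rfl).2.trans hg.2⟩
    rw [h1, h2, h.step t, hg.1, hg.2]
  · have h2 : {ω | Y ω = g ∧ ω ∈ {ω | X t ω = x ∧ F t ω = f}} = ∅ := by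
      rw [Set.eq_empty_iff_forall_notMem]
      rintro ω ⟨H, H1, H2⟩
      have := (hYeq g ω).1 H t le_rfl
      exact hg ⟨this.1.symm.trans H1, this.2.symm.trans H2⟩
    rw [h2, measure_empty, zero_mul]
    exact measure_mono_null (fun ω H => h2.le ⟨H.1, H.2.1, H.2.2.1⟩) measure_empty

theorem ae_mem_support (h : IsRun μ K X F) (t : ℕ) :
    ∀ᵐ ω ∂μ, X (t + 1) ω ∈ (K (F t ω) (X t ω)).support := by
  have key : ∀ x f y, ∀ᵐ ω ∂μ, X t ω = x → F t ω = f → X (t + 1) ω = y →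
      y ∈ (K f x).support := by
    intro x f y
    by_cases hy : y ∈ (K f x).support
    · exact Eventually.of_forall fun _ _ _ _ => hy
    · have h0 := h.measure_step t x f y
      rw [PMF.mem_support_iff, not_not] at hy
      rw [hy, mul_zero] at h0
      have := measure_eq_zero_iff_ae_notMem.1 h0
      filter_upwards [this] with ω hω h1 h2 h3
      exact absurd ⟨h1, h2, h3⟩ hω
  have := ae_all_iff.2 fun x => ae_all_iff.2 fun f => ae_all_iff.2 (key x f)
  filter_upwards [this] with ω hω
  exact hω _ _ _ rfl rfl rfl

theorem measure_succ (h : IsRun μ K X F) {K₀ : Config n L → PMF (Config n L)} {t : ℕ}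
    (hK : ∀ᵐ ω ∂μ, K (F t ω) (X t ω) = K₀ (X t ω)) (y : Config n L) :
    μ {ω | X (t + 1) ω = y} = ∑ x, μ {ω | X t ω = x} * K₀ x y := by
  rw [measure_eq_sum_fibers μ (X t) (h.measurableSet_config t)]
  refine Finset.sum_congr rfl fun x _ => ?_
  rw [measure_eq_sum_fibers μ (F t) (h.measurableSet_food t),
    measure_eq_sum_fibers μ (F t) (h.measurableSet_food t) {ω | X t ω = x}, Finset.sum_mul]
  refine Finset.sum_congr rfl fun f _ => ?_
  have h1 : {ω | F t ω = f ∧ ω ∈ {ω | X t ω = x ∧ ω ∈ {ω | X (t + 1) ω = y}}} =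
      {ω | X t ω = x ∧ F t ω = f ∧ X (t + 1) ω = y} := by
    ext ω; simp only [Set.mem_ofPred_eq]; tauto
  have h2 : {ω | F t ω = f ∧ ω ∈ {ω | X t ω = x}} = {ω | X t ω = x ∧ F t ω = f} := by
    ext ω; simp only [Set.mem_ofPred_eq]; tauto
  rw [h1, h2, h.measure_step]
  by_cases h0 : μ {ω | X t ω = x ∧ F t ω = f} = 0
  · rw [h0, zero_mul, zero_mul]
  -- An event of positive measure contains a point at which the almost sure identity of kernels
  -- holds; that identity depends only on `x` and `f`.
  · obtain ⟨ω, hω, hω'⟩ : ∃ ω, (X t ω = x ∧ F t ω = f) ∧ K (F t ω) (X t ω) = K₀ (X t ω) := by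
      by_contra! hne
      refine h0 (measure_eq_zero_iff_ae_notMem.2 ?_)
      filter_upwards [hK] with ω h1 h2
      exact hne ω h2 h1
    rw [hω.1, hω.2] at hω'
    rw [hω']

end IsRun

/-! ### Drift of the potential -/

section Drift

variable {n L : ℕ} [NeZero n] [NeZero L] {p lam : ℝ} {Δ : ℕ} {χ : AlertChoice n L}

theorem sum_compressionStep (c : Config n L) :
    ∑ y, compressionStep p lam Δ χ ∅ c y = 1 := by
  exact (tsum_fintype _).symm.trans (PMF.tsum_coe _)

theorem sum_compressionStep_mul_weight_le (c : Config n L) :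
    ∑ y, compressionStep p lam Δ χ ∅ c y * (y.weight : ℝ≥0∞) ≤ c.weight := by
  calc ∑ y, compressionStep p lam Δ χ ∅ c y * (y.weight : ℝ≥0∞)
      ≤ ∑ y, compressionStep p lam Δ χ ∅ c y * (c.weight : ℝ≥0∞) := by
        refine Finset.sum_le_sum fun y _ => ?_
        by_cases hy : y ∈ (compressionStep p lam Δ χ ∅ c).support
        · have := weight_le_of_mem_support hy
          gcongr
        · rw [PMF.mem_support_iff, not_not] at hy
          simp [hy]
    _ = c.weight := by rw [← Finset.sum_mul, sum_compressionStep, one_mul]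

theorem sum_compressionStep_mul_weight_add_le {c : Config n L} (hc : c.StateInvariant)
    (hc' : ¬ c.AllUnaware) :
    ∑ y, compressionStep p lam Δ χ ∅ c y * (y.weight : ℝ≥0∞) + (2 * (n : ℝ≥0∞))⁻¹ ≤ c.weight := by
  classical
  obtain ⟨z, hz, hz'⟩ := exists_weight_lt (p := p) (lam := lam) (Δ := Δ) (χ := χ) hc hc'
  calc ∑ y, compressionStep p lam Δ χ ∅ c y * (y.weight : ℝ≥0∞) + (2 * (n : ℝ≥0∞))⁻¹
      ≤ ∑ y, compressionStep p lam Δ χ ∅ c y * (y.weight : ℝ≥0∞) +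
          compressionStep p lam Δ χ ∅ c z := by gcongr
    -- The guaranteed mass at `z` is absorbed as one extra unit of weight there, which the strict
    -- decrease at `z` leaves room for.
    _ = ∑ y, compressionStep p lam Δ χ ∅ c y *
          ((y.weight + if y = z then 1 else 0 : ℕ) : ℝ≥0∞) := by
        simp [mul_add, Finset.sum_add_distrib]
    _ ≤ ∑ y, compressionStep p lam Δ χ ∅ c y * (c.weight : ℝ≥0∞) := by
        refine Finset.sum_le_sum fun y _ => ?_
        by_cases hy : y ∈ (compressionStep p lam Δ χ ∅ c).support
        · have : y.weight + (if y = z then 1 else 0) ≤ c.weight := by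
            split_ifs with h
            · subst h; omega
            · exact weight_le_of_mem_support hy
          gcongr
        · rw [PMF.mem_support_iff, not_not] at hy
          simp [hy]
    _ = c.weight := by rw [← Finset.sum_mul, sum_compressionStep, one_mul]

end Drift

/-! ### Runs without witnesses -/

section Run

variable {n L : ℕ} [NeZero L] {Ω : Type*} [MeasurableSpace Ω] {μ : Measure Ω}
  {K : Finset (Site L) → Config n L → PMF (Config n L)}
  {X : ℕ → Ω → Config n L} {F : ℕ → Ω → Finset (Site L)}

theorem IsRun.measurableSet_prop (h : IsRun μ K X F) (t : ℕ) (Q : Config n L → Prop) :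
    MeasurableSet {ω | Q (X t ω)} := by
  have : {ω | Q (X t ω)} = ⋃ x ∈ {x | Q x}, {ω | X t ω = x} := by
    ext ω; simp
  rw [this]
  exact MeasurableSet.biUnion (Set.to_countable _) fun x _ => h.measurableSet_config t x

open Classical in
theorem IsRun.measure_prop (h : IsRun μ K X F) (t : ℕ) (Q : Config n L → Prop) :
    μ {ω | Q (X t ω)} = ∑ x, if Q x then μ {ω | X t ω = x} else 0 := by
  rw [measure_eq_sum_fibers μ (X t) (h.measurableSet_config t)]
  refine Finset.sum_congr rfl fun x _ => ?_
  split_ifs with hQ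
  · congr 1
    ext ω
    simp only [Set.mem_ofPred_eq, and_iff_left_iff_imp]
    rintro rfl
    exact hQ
  · convert measure_empty (μ := μ)
    rw [Set.eq_empty_iff_forall_notMem]
    rintro ω ⟨rfl, h⟩
    exact hQ h

omit [NeZero L] [MeasurableSpace Ω] in
-- By absorption the first all-Unaware time is already final, and each earlier time contributes one
-- to the sum; if there is no such time the sum is infinite.
theorem unawareTime_le_tsum {T : ℕ} {ω : Ω}
    (hω : ∀ t ≥ T, (X t ω).AllUnaware → (X (t + 1) ω).AllUnaware) :
    unawareTime X T ω ≤ ∑' k, {ω | ¬ (X (T + k) ω).AllUnaware}.indicator 1 ω := by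
  classical
  by_cases hex : ∃ k, (X (T + k) ω).AllUnaware
  · have hstay : ∀ s ≥ T + Nat.find hex, (X s ω).AllUnaware := by
      intro s hs
      induction hs with
      | refl => exact Nat.find_spec hex
      | @step s hs ih => exact hω s ((Nat.le_add_right _ _).trans hs) ih
    refine (iInf₂_le _ hstay).trans ?_
    calc ((Nat.find hex : ℕ) : ℝ≥0∞) = ∑ k ∈ Finset.range (Nat.find hex), 1 := by simp
      _ = ∑ k ∈ Finset.range (Nat.find hex),
          {ω | ¬ (X (T + k) ω).AllUnaware}.indicator (1 : Ω → ℝ≥0∞) ω := by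
        refine Finset.sum_congr rfl fun k hk => ?_
        rw [Set.indicator_of_mem]
        · rfl
        · exact Nat.find_min hex (Finset.mem_range.1 hk)
      _ ≤ _ := ENNReal.sum_le_tsum _
  · push Not at hex
    have : ∀ k, {ω | ¬ (X (T + k) ω).AllUnaware}.indicator (1 : Ω → ℝ≥0∞) ω = 1 := by
      intro k
      rw [Set.indicator_of_mem]
      · rfl
      · exact hex k
    simp [this]

end Run

section CompressionRun

variable {n L : ℕ} [NeZero n] [NeZero L] {p lam : ℝ} {Δ : ℕ} {χ : AlertChoice n L}
  {Ω : Type*} [MeasurableSpace Ω] {μ : Measure Ω} {X : ℕ → Ω → Config n L}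
  {F : ℕ → Ω → Finset (Site L)} {T : ℕ}

theorem ae_stateInvariant (h : IsRun μ (compressionStep p lam Δ χ) X F)
    (h0 : ∀ᵐ ω ∂μ, (X 0 ω).StateInvariant) (t : ℕ) : ∀ᵐ ω ∂μ, (X t ω).StateInvariant := by
  induction t with
  | zero => exact h0
  | succ t ih =>
    filter_upwards [ih, h.ae_mem_support t] with ω h1 h2
    exact h1.compressionStep h2

omit [NeZero L] in
theorem ae_compressionStep_eq (hF : ∀ t ≥ T, ∀ᵐ ω ∂μ, (X t ω).witnesses (F t ω) = ∅) {t : ℕ}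
    (ht : T ≤ t) : ∀ᵐ ω ∂μ, compressionStep p lam Δ χ (F t ω) (X t ω) =
      compressionStep p lam Δ χ ∅ (X t ω) := by
  filter_upwards [hF t ht] with ω hω
  exact compressionStep_eq_of_witnesses_eq_empty hω

theorem ae_allUnaware_succ (h : IsRun μ (compressionStep p lam Δ χ) X F)
    (hF : ∀ t ≥ T, ∀ᵐ ω ∂μ, (X t ω).witnesses (F t ω) = ∅) {t : ℕ} (ht : T ≤ t) :
    ∀ᵐ ω ∂μ, (X t ω).AllUnaware → (X (t + 1) ω).AllUnaware := by
  filter_upwards [h.ae_mem_support t, ae_compressionStep_eq (p := p) (lam := lam) (Δ := Δ)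
    (χ := χ) hF ht] with ω h1 h2 h3
  rw [h2] at h1
  exact h3.of_mem_support h1

/-- The one-step drift is averaged over the law at time `t`; configurations of positive mass satisfy
the invariant, so the strict drift applies to those not yet all Unaware. -/
theorem expected_weight_add_le (h : IsRun μ (compressionStep p lam Δ χ) X F)
    (h0 : ∀ᵐ ω ∂μ, (X 0 ω).StateInvariant)
    (hF : ∀ t ≥ T, ∀ᵐ ω ∂μ, (X t ω).witnesses (F t ω) = ∅) {t : ℕ} (ht : T ≤ t) :
    ∑ x, μ {ω | X (t + 1) ω = x} * (x.weight : ℝ≥0∞) +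
        μ {ω | ¬ (X t ω).AllUnaware} * (2 * (n : ℝ≥0∞))⁻¹ ≤
      ∑ x, μ {ω | X t ω = x} * (x.weight : ℝ≥0∞) := by
  classical
  simp only [h.measure_succ (ae_compressionStep_eq hF ht)]
  rw [h.measure_prop t fun x => ¬ x.AllUnaware]
  simp only [Finset.sum_mul]
  rw [Finset.sum_comm, ← Finset.sum_add_distrib]
  refine Finset.sum_le_sum fun x _ => ?_
  simp only [mul_assoc]
  rw [← Finset.mul_sum]
  by_cases hx : μ {ω | X t ω = x} = 0
  · simp [hx]
  have hinv : x.StateInvariant := by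
    by_contra hne
    refine hx (measure_eq_zero_iff_ae_notMem.2 ?_)
    filter_upwards [ae_stateInvariant h h0 t] with ω h1 h2
    exact hne (h2 ▸ h1)
  split_ifs with hu
  · rw [zero_mul, add_zero]
    gcongr
    exact sum_compressionStep_mul_weight_le x
  · rw [← mul_add]
    gcongr
    exact sum_compressionStep_mul_weight_add_le hinv hu

theorem tsum_measure_not_allUnaware_le [IsProbabilityMeasure μ]
    (h : IsRun μ (compressionStep p lam Δ χ) X F)
    (h0 : ∀ᵐ ω ∂μ, (X 0 ω).StateInvariant)
    (hF : ∀ t ≥ T, ∀ᵐ ω ∂μ, (X t ω).witnesses (F t ω) = ∅) :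
    ∑' k, μ {ω | ¬ (X (T + k) ω).AllUnaware} ≤ 4 * (n : ℝ≥0∞) ^ 2 := by
  set e : ℕ → ℝ≥0∞ := fun t => ∑ x, μ {ω | X t ω = x} * (x.weight : ℝ≥0∞) with he
  -- Telescoping, kept in additive form since subtraction in `ℝ≥0∞` is truncated.
  have hsum : ∀ m, (∑ k ∈ Finset.range m, μ {ω | ¬ (X (T + k) ω).AllUnaware}) *
      (2 * (n : ℝ≥0∞))⁻¹ + e (T + m) ≤ e T := by
    intro m
    induction m with
    | zero => simp
    | succ m ih =>
      refine le_trans ?_ ih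
      rw [Finset.sum_range_succ, add_mul, add_assoc]
      gcongr
      rw [add_comm]
      exact expected_weight_add_le h h0 hF (Nat.le_add_right T m)
  have heT : e T ≤ 2 * n := by
    have h1 : ∑ x, μ {ω | X T ω = x} = 1 := by
      have := h.measure_prop T fun _ => True
      simpa using this.symm
    calc e T ≤ ∑ x, μ {ω | X T ω = x} * (2 * n) := by
          refine Finset.sum_le_sum fun x _ => ?_
          gcongr
          exact_mod_cast x.weight_le
      _ = 2 * n := by rw [← Finset.sum_mul, h1, one_mul]
  refine ENNReal.tsum_le_of_sum_range_le fun m => ?_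
  have h2 : (∑ k ∈ Finset.range m, μ {ω | ¬ (X (T + k) ω).AllUnaware}) *
      (2 * (n : ℝ≥0∞))⁻¹ ≤ 2 * n := le_self_add.trans ((hsum m).trans heT)
  rw [← div_eq_mul_inv, ENNReal.div_le_iff (by simp [NeZero.ne n])
    (ENNReal.mul_ne_top (by simp) (by simp))] at h2
  refine h2.trans (le_of_eq ?_)
  ring

theorem lintegral_unawareTime_le [IsProbabilityMeasure μ]
    (h : IsRun μ (compressionStep p lam Δ χ) X F)
    (h0 : ∀ᵐ ω ∂μ, (X 0 ω).StateInvariant)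
    (hF : ∀ t ≥ T, ∀ᵐ ω ∂μ, (X t ω).witnesses (F t ω) = ∅) :
    ∫⁻ ω, unawareTime X T ω ∂μ ≤ 4 * (n : ℝ≥0∞) ^ 2 := by
  have hmeas : ∀ k, MeasurableSet {ω | ¬ (X (T + k) ω).AllUnaware} := fun k =>
    h.measurableSet_prop (T + k) fun x => ¬ x.AllUnaware
  calc ∫⁻ ω, unawareTime X T ω ∂μ
      ≤ ∫⁻ ω, ∑' k, {ω | ¬ (X (T + k) ω).AllUnaware}.indicator 1 ω ∂μ := by
        refine lintegral_mono_ae ?_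
        have : ∀ᵐ ω ∂μ, ∀ t ≥ T, (X t ω).AllUnaware → (X (t + 1) ω).AllUnaware :=
          ae_all_iff.2 fun t => ae_all_iff.2 fun ht => ae_allUnaware_succ h hF ht
        filter_upwards [this] with ω hω
        exact unawareTime_le_tsum hω
    _ = ∑' k, μ {ω | ¬ (X (T + k) ω).AllUnaware} := by
        rw [lintegral_tsum fun k => (measurable_one.indicator (hmeas k)).aemeasurable]
        exact tsum_congr fun k => lintegral_indicator_one (hmeas k)
    _ ≤ _ := tsum_measure_not_allUnaware_le h h0 hF

/-! ### Convergence of the placements -/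

theorem sum_measureReal_unawareAt (h : IsRun μ (compressionStep p lam Δ χ) X F)
    [IsProbabilityMeasure μ] (t : ℕ) :
    ∑ x, μ.real {ω | X t ω = unawareAt x} = 1 - μ.real {ω | ¬ (X t ω).AllUnaware} := by
  have hm := h.measurableSet_prop t fun x => ¬ x.AllUnaware
  have hdisj : Pairwise (Function.onFun Disjoint fun x : Fin n ↪ Site L =>
      {ω | X t ω = unawareAt x}) := fun x y hxy =>
    Set.disjoint_left.2 fun ω h1 h2 => hxy (unawareAt_injective (h1.symm.trans h2))
  have := probReal_compl_eq_one_sub (μ := μ) hm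
  rw [← this, ← measureReal_biUnion_finset (hdisj.set_pairwise _)
    fun x _ => h.measurableSet_config t _]
  congr 1
  ext ω
  simp only [Finset.mem_univ, Set.iUnion_true, Set.mem_iUnion, Set.mem_ofPred_eq, Set.mem_compl_iff,
    not_not]
  constructor
  · rintro ⟨x, hx⟩
    rw [hx]
    exact allUnaware_unawareAt x
  · exact fun hu => ⟨_, hu.eq_unawareAt⟩

/-- Only mass already all Unaware at time `t` is followed; further mass may still join later, whence
an inequality. -/
theorem sum_mul_exclusionMatrix_pow_le [IsProbabilityMeasure μ]
    (h : IsRun μ (compressionStep p lam Δ χ) X F)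
    (hF : ∀ t ≥ T, ∀ᵐ ω ∂μ, (X t ω).witnesses (F t ω) = ∅) {t : ℕ} (ht : T ≤ t) (k : ℕ)
    (y : Fin n ↪ Site L) :
    ∑ x, μ.real {ω | X t ω = unawareAt x} * (exclusionMatrix n L ^ k) x y ≤
      μ.real {ω | X (t + k) ω = unawareAt y} := by
  have one : ∀ s ≥ T, ∀ y, ∑ x, μ.real {ω | X s ω = unawareAt x} * exclusionMatrix n L x y ≤
      μ.real {ω | X (s + 1) ω = unawareAt y} := by
    intro s hs y
    have hle : ∑ x, μ {ω | X s ω = unawareAt x} * exclusionKernel x y ≤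
        μ {ω | X (s + 1) ω = unawareAt y} := by
      rw [h.measure_succ (ae_compressionStep_eq hF hs)]
      simp only [← compressionStep_unawareAt p lam Δ χ]
      refine (Finset.sum_map Finset.univ ⟨unawareAt, unawareAt_injective⟩
        fun c => μ {ω | X s ω = c} * compressionStep p lam Δ χ ∅ c (unawareAt y)).symm.le.trans ?_
      exact Finset.sum_le_sum_of_subset (Finset.subset_univ _)
    have := ENNReal.toReal_mono (measure_ne_top μ _) hle
    rw [ENNReal.toReal_sum fun x _ =>
      ENNReal.mul_ne_top (measure_ne_top μ _) (exclusionKernel_ne_top x y)] at this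
    simp only [ENNReal.toReal_mul] at this
    exact this
  induction k generalizing y with
  | zero => simp [Matrix.one_apply]
  | succ k ih =>
    refine le_trans ?_ (one (t + k) (ht.trans (Nat.le_add_right _ _)) y)
    calc ∑ x, μ.real {ω | X t ω = unawareAt x} * (exclusionMatrix n L ^ (k + 1)) x y
        = ∑ z, (∑ x, μ.real {ω | X t ω = unawareAt x} * (exclusionMatrix n L ^ k) x z) *
            exclusionMatrix n L z y := by
          simp only [pow_succ, Matrix.mul_apply, Finset.mul_sum, Finset.sum_mul, mul_assoc]
          exact Finset.sum_comm
      _ ≤ _ := Finset.sum_le_sum fun z _ => mul_le_mul_of_nonneg_right (ih z)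
          (nonneg_of_mem_doublyStochastic exclusionMatrix_mem)

/-- Probability vectors whose entries are eventually almost at least uniform become uniform. -/
theorem tendsto_inv_card_of_eventually_lt {E : Type*} [Fintype E] {g : ℕ → E → ℝ}
    (hsum : ∀ t, ∑ x, g t x = 1)
    (hlow : ∀ x, ∀ c < (Fintype.card E : ℝ)⁻¹, ∀ᶠ t in atTop, c < g t x) (x : E) :
    Tendsto (fun t => g t x) atTop (𝓝 (Fintype.card E : ℝ)⁻¹) := by
  classical
  have hN : (0 : ℝ) < Fintype.card E := Nat.cast_pos.2 (Fintype.card_pos_iff.2 ⟨x⟩)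
  set N : ℝ := (Fintype.card E : ℝ) with hNdef
  refine tendsto_order.2 ⟨hlow x, fun c hc => ?_⟩
  -- If each of the other `N - 1` entries exceeds `N⁻¹ - η`, the remaining one is at most `N⁻¹ + (N
  -- - 1) * η`, which is below `c`.
  set η := (c - N⁻¹) / N with hη
  have hη0 : 0 < η := div_pos (sub_pos.2 hc) hN
  have hall : ∀ᶠ t in atTop, ∀ y, N⁻¹ - η < g t y :=
    eventually_all.2 fun y => hlow y _ (by linarith)
  filter_upwards [hall] with t ht
  have h1 : ∑ y ∈ Finset.univ.erase x, (N⁻¹ - η) ≤ ∑ y ∈ Finset.univ.erase x, g t y :=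
    Finset.sum_le_sum fun y _ => (ht y).le
  have h2 := Finset.add_sum_erase Finset.univ (fun y => g t y) (Finset.mem_univ x)
  rw [hsum] at h2
  have h3 := Finset.add_sum_erase Finset.univ (fun _ : E => N⁻¹ - η) (Finset.mem_univ x)
  have h4 : ∑ _y : E, (N⁻¹ - η) = 1 - (c - N⁻¹) := by
    rw [Finset.sum_const, Finset.card_univ, nsmul_eq_mul, ← hNdef, hη]
    field_simp
  rw [h4] at h3
  linarith

theorem tendsto_measure_pos [IsProbabilityMeasure μ]
    (h : IsRun μ (compressionStep p lam Δ χ) X F)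
    (h0 : ∀ᵐ ω ∂μ, (X 0 ω).StateInvariant)
    (hF : ∀ t ≥ T, ∀ᵐ ω ∂μ, (X t ω).witnesses (F t ω) = ∅) (hn : n < L ^ 2)
    (x : Fin n ↪ Site L) :
    Tendsto (fun t => μ {ω | (X t ω).pos = x}) atTop
      (𝓝 ((Nat.card (Fin n ↪ Site L) : ℝ≥0∞)⁻¹)) := by
  have hN : (0 : ℝ) < Fintype.card (Fin n ↪ Site L) :=
    Nat.cast_pos.2 (Fintype.card_pos_iff.2 ⟨x⟩)
  have hb : Tendsto (fun k => μ.real {ω | ¬ (X (T + k) ω).AllUnaware}) atTop (𝓝 0) := by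
    have := ENNReal.tendsto_atTop_zero_of_tsum_ne_top (ne_top_of_le_ne_top
      (ENNReal.mul_ne_top (by simp) (ENNReal.pow_ne_top (by simp)))
      (tsum_measure_not_allUnaware_le h h0 hF))
    exact (ENNReal.tendsto_toReal_zero_iff fun k => measure_ne_top μ _).2 this
  rw [← ENNReal.tendsto_toReal_iff (fun t => measure_ne_top μ _)
    (ENNReal.inv_ne_top.2 (by simpa [Nat.card_eq_fintype_card] using hN.ne'))]
  rw [ENNReal.toReal_inv, ENNReal.toReal_natCast, Nat.card_eq_fintype_card]
  refine tendsto_inv_card_of_eventually_lt (g := fun t x => (μ {ω | (X t ω).pos = x}).toReal)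
    (fun t => ?_) (fun y c hc => ?_) x
  · have := measure_eq_sum_fibers μ (fun ω => (X t ω).pos)
      (fun x => h.measurableSet_prop t fun c => c.pos = x) Set.univ
    simp only [measure_univ, Set.mem_univ, and_true] at this
    rw [← ENNReal.toReal_sum fun x _ => measure_ne_top μ _, ← this, ENNReal.toReal_one]
  · have hlim1 : Tendsto (fun k => (1 - μ.real {ω | ¬ (X (T + k) ω).AllUnaware}) *
        (Fintype.card (Fin n ↪ Site L) : ℝ)⁻¹) atTop
        (𝓝 ((1 - 0) * (Fintype.card (Fin n ↪ Site L) : ℝ)⁻¹)) :=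
      (tendsto_const_nhds.sub hb).mul_const _
    -- The waiting time `s` is fixed first, so that almost all mass is all Unaware at time `T + s`;
    -- only then does the mixing time `k` tend to infinity.
    obtain ⟨s, hs⟩ := (hlim1.eventually (lt_mem_nhds (by simpa using hc))).exists
    have hlim2 : Tendsto (fun k => ∑ x, μ.real {ω | X (T + s) ω = unawareAt x} *
        (exclusionMatrix n L ^ k) x y) atTop (𝓝 (∑ x, μ.real {ω | X (T + s) ω = unawareAt x} *
          (Fintype.card (Fin n ↪ Site L) : ℝ)⁻¹)) :=
      tendsto_finsetSum _ fun x _ => (tendsto_exclusionMatrix_pow hn x y).const_mul _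
    rw [← Finset.sum_mul, sum_measureReal_unawareAt h] at hlim2
    have hev := hlim2.eventually (lt_mem_nhds hs)
    obtain ⟨k₀, hk₀⟩ := eventually_atTop.1 hev
    refine eventually_atTop.2 ⟨T + s + k₀, fun t ht => ?_⟩
    obtain ⟨k, rfl⟩ := Nat.exists_eq_add_of_le (show T + s ≤ t by omega)
    refine (hk₀ k (by omega)).trans_le ?_
    refine (sum_mul_exclusionMatrix_pow_le h hF (Nat.le_add_right T s) k y).trans ?_
    refine measureReal_mono fun ω hω => ?_
    change (X (T + s + k) ω).pos = y
    rw [show X (T + s + k) ω = unawareAt y from hω]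
    rfl

/-! ### From labelled placements to occupied sets -/

omit [NeZero n] in
theorem card_filter_map_eq {S : Finset (Site L)} (hS : S.card = n) :
    (Finset.univ.filter fun x : Fin n ↪ Site L => Finset.univ.map x = S).card = n.factorial := by
  have e : {x : Fin n ↪ Site L // Finset.univ.map x = S} ≃ (Fin n ↪ S) :=
    { toFun := fun x => ⟨fun v => ⟨x.1 v, x.2.le (by simp)⟩, fun v w hvw =>
        x.1.injective (congrArg Subtype.val hvw)⟩
      invFun := fun y => ⟨y.trans (Function.Embedding.subtype _), by
        refine Finset.eq_of_subset_of_card_le ?_ (by simp [hS])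
        intro s hs
        obtain ⟨v, -, rfl⟩ := Finset.mem_map.1 hs
        exact (y v).2⟩
      left_inv := fun x => rfl
      right_inv := fun y => rfl }
  rw [← Fintype.card_subtype, Fintype.card_congr e, Fintype.card_embedding_eq, Fintype.card_coe, hS,
    Fintype.card_fin, Nat.descFactorial_self]

theorem tendsto_measure_occupied [IsProbabilityMeasure μ]
    (h : IsRun μ (compressionStep p lam Δ χ) X F)
    (h0 : ∀ᵐ ω ∂μ, (X 0 ω).StateInvariant)
    (hF : ∀ t ≥ T, ∀ᵐ ω ∂μ, (X t ω).witnesses (F t ω) = ∅) {S : Finset (Site L)}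
    (hS : S.card = n) :
    Tendsto (fun t => μ {ω | (X t ω).occupied = S}) atTop (𝓝 (((L ^ 2).choose n : ℝ≥0∞)⁻¹)) := by
  have hcard : Fintype.card (Site L) = L ^ 2 := by simp [ZMod.card, sq]
  have hle : n ≤ L ^ 2 := by rw [← hS, ← hcard]; exact Finset.card_le_univ S
  -- On a full lattice there is only one `n`-set of sites. Otherwise each set is the image of
  -- exactly `n!` labelled placements, and their limits are added.
  rcases hle.eq_or_lt with heq | hlt
  · have hocc : ∀ c : Config n L, c.occupied = S := by
      intro c
      have h1 : c.occupied = Finset.univ := by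
        rw [← Finset.card_eq_iff_eq_univ, hcard, ← heq]
        simp [Config.occupied]
      rw [h1, eq_comm, ← Finset.card_eq_iff_eq_univ, hcard, hS, heq]
    simp [hocc, ← heq]
  · have hfib : ∀ t, μ {ω | (X t ω).occupied = S} =
        ∑ x ∈ Finset.univ.filter (fun x : Fin n ↪ Site L => Finset.univ.map x = S),
          μ {ω | (X t ω).pos = x} := by
      intro t
      rw [measure_eq_sum_fibers μ (fun ω => (X t ω).pos)
        fun x => h.measurableSet_prop t fun c => c.pos = x, Finset.sum_filter]
      refine Finset.sum_congr rfl fun x _ => ?_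
      split_ifs with hx
      · congr 1
        ext ω
        simp only [Set.mem_ofPred_eq, and_iff_left_iff_imp]
        rintro rfl
        exact hx
      · convert measure_empty (μ := μ)
        rw [Set.eq_empty_iff_forall_notMem]
        rintro ω ⟨rfl, h⟩
        exact hx h
    simp only [hfib]
    have hlim := tendsto_finsetSum
      (Finset.univ.filter fun x : Fin n ↪ Site L => Finset.univ.map x = S)
      fun x _ => tendsto_measure_pos h h0 hF hlt x
    convert hlim using 2
    rw [Finset.sum_const, card_filter_map_eq hS, nsmul_eq_mul, Nat.card_eq_fintype_card,
      Fintype.card_embedding_eq, hcard, Fintype.card_fin, Nat.descFactorial_eq_factorial_mul_choose,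
      Nat.cast_mul, ENNReal.mul_inv (by simp [Nat.factorial_ne_zero]) (by simp), ← mul_assoc,
      ENNReal.mul_inv_cancel (by simp [Nat.factorial_ne_zero]) (by simp), one_mul]

end CompressionRun

end

theorem mainTheorem7 :
    ∃ C : ℝ≥0, ∀ (w : ℕ) (p lam : ℝ) (Δ : ℕ),
      1 ≤ w → 0 < p → p < 1 / (w : ℝ) → 0 < lam → 6 ≤ Δ →
      ∀ (n L : ℕ) [NeZero n] [NeZero L] (χ : AlertChoice n L)
        {Ω : Type*} [MeasurableSpace Ω] (μ : Measure Ω) [IsProbabilityMeasure μ]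
        (X : ℕ → Ω → Config n L) (F : ℕ → Ω → Finset (Site L)) (T : ℕ),
        IsRun μ (compressionStep p lam Δ χ) X F →
        (∀ᵐ ω ∂μ, (X 0 ω).StateInvariant) →
        (∀ t, ∀ᵐ ω ∂μ, ((X t ω).witnesses (F t ω)).card ≤ w) →
        (∀ t ≥ T, ∀ᵐ ω ∂μ, (X t ω).witnesses (F t ω) = ∅) →
        -- all agents reach and remain Unaware, after `O(n ^ 2)` expected iterations
        (∫⁻ ω, unawareTime X T ω ∂μ ≤ (C : ℝ≥0∞) * (n : ℝ≥0∞) ^ 2) ∧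
        -- the set of occupied sites converges to a uniformly distributed `n`-set of sites
        (∀ S : Finset (Site L), S.card = n →
          Tendsto (fun t => μ {ω | (X t ω).occupied = S}) atTop
            (𝓝 (((L ^ 2).choose n : ℝ≥0∞)⁻¹))) ∧
        -- if a site is free, so does the joint placement of the individual agents
        (n < L ^ 2 → ∀ x : Fin n ↪ Site L,
          Tendsto (fun t => μ {ω | (X t ω).pos = x}) atTop
            (𝓝 ((Nat.card (Fin n ↪ Site L) : ℝ≥0∞)⁻¹))) := by
  refine ⟨4, ?_⟩
  intro w p lam Δ _ _ _ _ _ n L _ _ χ Ω _ μ _ X F T hrun h0 _ hF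
  exact ⟨by simpa using lintegral_unawareTime_le hrun h0 hF,
    fun S hS => tendsto_measure_occupied hrun h0 hF hS,
    fun hn x => tendsto_measure_pos hrun h0 hF hn x⟩
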